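/- Let $\mathcal A$ be a unital $C^*$-algebra, and let $\mathcal M_1,\mathcal M_2$ be (left) Hilbert $\mathcal A$-modules, with $\mathcal A$-valued inner products $\langle\cdot,\cdot\rangle$ that are linear in the first variable. Let $\mathcal A\otimes\mathcal A$ be the spatial tensor product, and let $\mathcal M_1\otimes\mathcal M_2$ be the exterior tensor product: the Hilbert $\mathcal A\otimes\mathcal A$-module obtained by completing the algebraic tensor product for $\langle x\otimes y,x'\otimes y'\rangle=\langle x,x'\rangle\otimes\langle y,y'\rangle$. Let $(\Omega_1,\mu_1)$, $(\Omega_2,\mu_2)$ be measure spaces and let $\mu$ be a product measure on $\Omega_1\times\Omega_2$, i.e. $\mu(E\times F)=\mu_1(E)\mu_2(F)$ for all measurable $E,F$. *Definitions.* Let $\mathcal M$ be a Hilbert module, $(\Omega,\nu)$ a measure space and $\mathcal X,\mathcal Y:\Omega\to\mathcal M$. Let $T$ be a set of test vectors: $T=\mathcal M$ if $\mathcal M=\mathcal M_1$ or $\mathcal M_2$, and $T=\{f\otimes g: f\in\mathcal M_1,\ g\in\mathcal M_2\}$ if $\mathcal M=\mathcal M_1\otimes\mathcal M_2$. The pair $(\mathcal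 X,\mathcal Y)$ is a *continuous biframe with bounds $A,B$* if $0<A\le B<\infty$ and, for every $f\in T$, the functions $\langle f,\mathcal X(\cdot)\rangle$ and $\langle f,\mathcal Y(\cdot)\rangle$ are (almost everywhere strongly) measurable, $\langle f,\mathcal X(\cdot)\rangle\langle\mathcal Y(\cdot),f\rangle$ is Bochner integrable, and $$A\langle f,f\rangle\le\int_\Omega\langle f,\mathcal X(\omega)\rangle\langle\mathcal Y(\omega),f\rangle\,d\nu(\omega)\le B\langle f,f\rangle .$$ A map $S:\mathcal M\to\mathcal M$ is a *biframe operator* of $(\mathcal X,\mathcal Y)$ if $Sf=\int_\Omega\langle f,\mathcal X(\omega)\rangle\mathcal Y(\omega)\,d\nu(\omega)$ weakly for $f\in T$, that is, for all $f,h\in T$ the function $\langle f,\mathcal X(\cdot)\rangle\langle\mathcal Y(\cdot),h\rangle$ is Bochner integrable and $$\langle Sf,h\rangle=\int_\Omega\langle f,\mathcal X(\omega)\rangle\langle\mathcal Y(\omega),h\rangle\,d\nu(\omega).$$ For operators, $S\le T$ means $\langle Sx,x\rangle\le\langle Tx,x\rangle$ for all $x\in\mathcal M$, and $\mathrm{End}^*(\mathcal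 M)$ is the algebra of adjointable operators. *Statement.* Let $(\mathcal X_1,\mathcal Y_1)$ be a continuous biframe for $\mathcal M_1$ with respect to $(\Omega_1,\mu_1)$ with bounds $A,B$, and $(\mathcal X_2,\mathcal Y_2)$ a continuous biframe for $\mathcal M_2$ with respect to $(\Omega_2,\mu_2)$ with bounds $C,D$, and let both have biframe operators $S_{(\mathcal X_1,\mathcal Y_1)}$ and $S_{(\mathcal X_2,\mathcal Y_2)}$. Put $\mathcal X(\omega_1,\omega_2)=\mathcal X_1(\omega_1)\otimes\mathcal X_2(\omega_2)$ and $\mathcal Y(\omega_1,\omega_2)=\mathcal Y_1(\omega_1)\otimes\mathcal Y_2(\omega_2)$. Then: 1. $(\mathcal X,\mathcal Y)$ is a continuous biframe for $\mathcal M_1\otimes\mathcal M_2$ with respect to $(\Omega_1\times\Omega_2,\mu)$ with bounds $AC$, $BD$. 2. Among the bounded linear operators on $\mathcal M_1\otimes\mathcal M_2$ there is exactly one biframe operator $S=S_{(\mathcal X,\mathcal Y)}$ of $(\mathcal X,\mathcal Y)$, and it is adjointable. If $f\in\mathcal M_1$ and $g\in\mathcal M_2$ are such that $\langle f,\mathcal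 X_1(\cdot)\rangle\mathcal Y_1(\cdot)$ and $\langle g,\mathcal X_2(\cdot)\rangle\mathcal Y_2(\cdot)$ are Bochner integrable, then so is $\langle f\otimes g,\mathcal X(\cdot)\rangle\mathcal Y(\cdot)$, and $S(f\otimes g)$ is its Bochner integral. 3. $AC\cdot I\le S\le BD\cdot I$. 4. $S$ is positive and is invertible in $\mathrm{End}^*(\mathcal M_1\otimes\mathcal M_2)$, and its spectrum in $\mathrm{End}^*(\mathcal M_1\otimes\mathcal M_2)$ is contained in $[AC,BD]\subset(0,\infty)$. -/

import Mathlib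

open MeasureTheory
open scoped TensorProduct

set_option linter.unusedSectionVars false

namespace TensorBiframe

noncomputable section

/-! ### The spatial tensor product of two unital C⋆-algebras -/

section Spatial

variable {A B H K : Type*} [CStarAlgebra A] [CStarAlgebra B]
  [NormedAddCommGroup H] [InnerProductSpace ℂ H]
  [NormedAddCommGroup K] [InnerProductSpace ℂ K]

variable (H K) in
/-- The Hilbert space tensor product `H ⊗ K`: the completion of the algebraic tensor product
for the inner product `⟪x ⊗ y, x' ⊗ y'⟫ = ⟪x, x'⟫ ⟪y, y'⟫`. -/
def HilbertTensor := UniformSpace.Completion (H ⊗[ℂ] K)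

instance : NormedAddCommGroup (HilbertTensor H K) :=
  inferInstanceAs (NormedAddCommGroup (UniformSpace.Completion (H ⊗[ℂ] K)))

instance : InnerProductSpace ℂ (HilbertTensor H K) :=
  inferInstanceAs (InnerProductSpace ℂ (UniformSpace.Completion (H ⊗[ℂ] K)))

instance : CompleteSpace (HilbertTensor H K) :=
  inferInstanceAs (CompleteSpace (UniformSpace.Completion (H ⊗[ℂ] K)))

/-- The elementary tensor `x ⊗ y` in `H ⊗ K`. -/
def htmul (x : H) (y : K) : HilbertTensor H K :=
  ((x ⊗ₜ[ℂ] y : H ⊗[ℂ] K) : UniformSpace.Completion (H ⊗[ℂ] K))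

/-- The bounded operator `S ⊗ T` on `H ⊗ K`, with `(S ⊗ T)(x ⊗ y) = S x ⊗ T y`. -/
def opTensor (S : H →L[ℂ] H) (T : K →L[ℂ] K) : HilbertTensor H K →L[ℂ] HilbertTensor H K :=
  show UniformSpace.Completion (H ⊗[ℂ] K) →L[ℂ] UniformSpace.Completion (H ⊗[ℂ] K) from
    (TensorProduct.mapL S T).completion

theorem inner_htmul (x x' : H) (y y' : K) :
    inner ℂ (htmul x y) (htmul x' y') = inner ℂ x x' * inner ℂ y y' :=
  (UniformSpace.Completion.inner_coe _ _).trans (TensorProduct.inner_tmul ℂ x x' y y')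

theorem opTensor_htmul (S : H →L[ℂ] H) (T : K →L[ℂ] K) (x : H) (y : K) :
    opTensor S T (htmul x y) = htmul (S x) (T y) :=
  ((TensorProduct.mapL S T).completion_apply_coe _).trans
    (congrArg _ (TensorProduct.mapL_tmul S T x y))

theorem htmul_add_left (x x' : H) (y : K) : htmul (x + x') y = htmul x y + htmul x' y :=
  (congrArg _ (TensorProduct.add_tmul x x' y)).trans (UniformSpace.Completion.coe_add _ _)

theorem htmul_add_right (x : H) (y y' : K) : htmul x (y + y') = htmul x y + htmul x y' :=
  (congrArg _ (TensorProduct.tmul_add x y y')).trans (UniformSpace.Completion.coe_add _ _)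

theorem htmul_smul_left (c : ℂ) (x : H) (y : K) : htmul (c • x) y = c • htmul x y :=
  UniformSpace.Completion.coe_smul c (x ⊗ₜ[ℂ] y : H ⊗[ℂ] K)

theorem htmul_smul_right (c : ℂ) (x : H) (y : K) : htmul x (c • y) = c • htmul x y :=
  (congrArg _ (TensorProduct.tmul_smul c x y)).trans
    (UniformSpace.Completion.coe_smul c (x ⊗ₜ[ℂ] y : H ⊗[ℂ] K))

theorem hilbert_induction {p : HilbertTensor H K → Prop} (hc : IsClosed {z | p z})
    (h0 : p 0) (ht : ∀ x y, p (htmul x y)) (ha : ∀ u v, p u → p v → p (u + v))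
    (z : HilbertTensor H K) : p z := by
  refine UniformSpace.Completion.induction_on (α := H ⊗[ℂ] K) (p := p) z hc fun w => ?_
  induction w using TensorProduct.induction_on with
  | zero => exact h0
  | tmul x y => exact ht x y
  | add a b hA hB =>
    have : ((a + b : H ⊗[ℂ] K) : UniformSpace.Completion (H ⊗[ℂ] K)) = a + b :=
      UniformSpace.Completion.coe_add a b
    rw [this]
    exact ha _ _ hA hB

theorem hilbert_ext {f g : HilbertTensor H K →L[ℂ] HilbertTensor H K}
    (h : ∀ (x : H) (y : K), f (htmul x y) = g (htmul x y)) : f = g := by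
  ext z
  refine hilbert_induction (isClosed_eq f.continuous g.continuous) (by simp) h ?_ z
  intro u v hu hv
  rw [map_add, map_add, hu, hv]

theorem opTensor_mul (S S' : H →L[ℂ] H) (T T' : K →L[ℂ] K) :
    opTensor S T * opTensor S' T' = opTensor (S * S') (T * T') :=
  hilbert_ext fun x y => by simp [opTensor_htmul]

variable [CompleteSpace H] [CompleteSpace K]

theorem star_opTensor (S : H →L[ℂ] H) (T : K →L[ℂ] K) :
    star (opTensor S T) = opTensor (star S) (star T) := by
  symm
  rw [ContinuousLinearMap.star_eq_adjoint (opTensor S T), ContinuousLinearMap.eq_adjoint_iff]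
  intro u v
  refine hilbert_induction (p := fun u => inner ℂ (opTensor (star S) (star T) u) v =
    inner ℂ u (opTensor S T v)) (isClosed_eq (by fun_prop) (by fun_prop)) (by simp) ?_
    (fun a b ha hb => by simp only [map_add, inner_add_left, ha, hb]) u
  intro x y
  refine hilbert_induction (p := fun v => inner ℂ (opTensor (star S) (star T) (htmul x y)) v =
    inner ℂ (htmul x y) (opTensor S T v)) (isClosed_eq (by fun_prop) (by fun_prop)) (by simp) ?_
    (fun a b ha hb => by simp only [map_add, inner_add_right, ha, hb]) v
  intro x' y'
  simp [opTensor_htmul, inner_htmul, ContinuousLinearMap.star_eq_adjoint,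
    ContinuousLinearMap.adjoint_inner_left]

/-- The algebra homomorphism `π ⊗ ρ` on the algebraic tensor product, `a ⊗ b ↦ π a ⊗ ρ b`. -/
def spatialAlgHom (π : A →⋆ₐ[ℂ] (H →L[ℂ] H)) (ρ : B →⋆ₐ[ℂ] (K →L[ℂ] K)) :
    A ⊗[ℂ] B →ₐ[ℂ] (HilbertTensor H K →L[ℂ] HilbertTensor H K) :=
  Algebra.TensorProduct.algHomOfLinearMapTensorProduct
      (TensorProduct.lift (LinearMap.mk₂ ℂ (fun a b => opTensor (π a) (ρ b))
        (fun a a' b => hilbert_ext fun x y => by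
          simp [opTensor_htmul, htmul_add_left])
        (fun c a b => hilbert_ext fun x y => by
          simp [opTensor_htmul, htmul_smul_left])
        (fun a b b' => hilbert_ext fun x y => by
          simp [opTensor_htmul, htmul_add_right])
        (fun c a b => hilbert_ext fun x y => by
          simp [opTensor_htmul, htmul_smul_right])))
      (fun a a' b b' => by simp [opTensor_mul])
      (hilbert_ext fun x y => by simp [opTensor_htmul])

theorem spatialAlgHom_tmul (π : A →⋆ₐ[ℂ] (H →L[ℂ] H)) (ρ : B →⋆ₐ[ℂ] (K →L[ℂ] K))
    (a : A) (b : B) : spatialAlgHom π ρ (a ⊗ₜ b) = opTensor (π a) (ρ b) := rfl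

theorem spatialAlgHom_star (π : A →⋆ₐ[ℂ] (H →L[ℂ] H)) (ρ : B →⋆ₐ[ℂ] (K →L[ℂ] K))
    (t : A ⊗[ℂ] B) : spatialAlgHom π ρ (star t) = star (spatialAlgHom π ρ t) := by
  induction t using TensorProduct.induction_on with
  | zero => rw [star_zero, map_zero, star_zero]
  | tmul a b =>
    rw [TensorProduct.star_tmul, spatialAlgHom_tmul, spatialAlgHom_tmul, star_opTensor,
      map_star, map_star]
  | add s t hs ht => rw [star_add, map_add, map_add, star_add, hs, ht]

/-- The representation `π ⊗ ρ` of the algebraic tensor product `A ⊗ B` on `H ⊗ K`. -/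
def spatialRep (π : A →⋆ₐ[ℂ] (H →L[ℂ] H)) (ρ : B →⋆ₐ[ℂ] (K →L[ℂ] K)) :
    A ⊗[ℂ] B →⋆ₐ[ℂ] (HilbertTensor H K →L[ℂ] HilbertTensor H K) :=
  { spatialAlgHom π ρ with map_star' := spatialAlgHom_star π ρ }

@[simp] theorem spatialRep_tmul (π : A →⋆ₐ[ℂ] (H →L[ℂ] H)) (ρ : B →⋆ₐ[ℂ] (K →L[ℂ] K))
    (a : A) (b : B) : spatialRep π ρ (a ⊗ₜ b) = opTensor (π a) (ρ b) := rfl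

/-- The spatial tensor product `A ⊗ B`: the completion of the algebraic tensor product for the
spatial norm `‖t‖ = ‖(π ⊗ ρ) t‖`, where `π` and `ρ` are faithful representations of `A` and `B`
on Hilbert spaces, realised as the norm closure of the range of `π ⊗ ρ`. (The spatial norm does
not depend on the choice of the faithful representations.) -/
def SpatialTensor (π : A →⋆ₐ[ℂ] (H →L[ℂ] H)) (ρ : B →⋆ₐ[ℂ] (K →L[ℂ] K)) : Type _ :=
  (spatialRep π ρ).range.topologicalClosure

instance (π : A →⋆ₐ[ℂ] (H →L[ℂ] H)) (ρ : B →⋆ₐ[ℂ] (K →L[ℂ] K)) :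
    CStarAlgebra (SpatialTensor π ρ) :=
  haveI : IsClosed ((spatialRep π ρ).range.topologicalClosure :
      Set (HilbertTensor H K →L[ℂ] HilbertTensor H K)) :=
    StarSubalgebra.isClosed_topologicalClosure _
  inferInstanceAs (CStarAlgebra (spatialRep π ρ).range.topologicalClosure)

instance (π : A →⋆ₐ[ℂ] (H →L[ℂ] H)) (ρ : B →⋆ₐ[ℂ] (K →L[ℂ] K)) :
    PartialOrder (SpatialTensor π ρ) := CStarAlgebra.spectralOrder _

instance (π : A →⋆ₐ[ℂ] (H →L[ℂ] H)) (ρ : B →⋆ₐ[ℂ] (K →L[ℂ] K)) :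
    StarOrderedRing (SpatialTensor π ρ) := CStarAlgebra.spectralOrderedRing _

/-- The canonical map from the algebraic to the spatial tensor product of `A` and `B`. -/
def spatialMk (π : A →⋆ₐ[ℂ] (H →L[ℂ] H)) (ρ : B →⋆ₐ[ℂ] (K →L[ℂ] K)) :
    A ⊗[ℂ] B →⋆ₐ[ℂ] SpatialTensor π ρ :=
  (StarSubalgebra.inclusion (StarSubalgebra.le_topologicalClosure _)).comp
    (spatialRep π ρ).rangeRestrict

theorem norm_spatialMk (π : A →⋆ₐ[ℂ] (H →L[ℂ] H)) (ρ : B →⋆ₐ[ℂ] (K →L[ℂ] K)) (t : A ⊗[ℂ] B) :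
    ‖spatialMk π ρ t‖ = ‖spatialRep π ρ t‖ := rfl

theorem denseRange_spatialMk (π : A →⋆ₐ[ℂ] (H →L[ℂ] H)) (ρ : B →⋆ₐ[ℂ] (K →L[ℂ] K)) :
    DenseRange (spatialMk π ρ) := by
  intro z
  have hz := z.2
  rw [← SetLike.mem_coe, StarSubalgebra.topologicalClosure_coe] at hz
  have hi : Topology.IsInducing (fun w : SpatialTensor π ρ => w.1) :=
    Topology.IsInducing.subtypeVal
  rw [hi.closure_eq_preimage_closure_image]
  refine closure_mono ?_ hz
  rintro _ ⟨t, rfl⟩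
  exact ⟨spatialMk π ρ t, ⟨t, rfl⟩, rfl⟩

end Spatial
/-! ### Positivity of Gram matrices -/

section Gram

variable {A E : Type*} [CStarAlgebra A] [PartialOrder A] [StarOrderedRing A]
  [NormedAddCommGroup E] [NormedSpace ℂ E] [Module A E] [CStarModule A E]

theorem eq_zero_of_sum_star_mul_self {ι : Type*} (s : Finset ι) (f : ι → A)
    (h : ∑ i ∈ s, star (f i) * f i = 0) : ∀ i ∈ s, f i = 0 := by
  intro i hi
  have := (Finset.sum_eq_zero_iff_of_nonneg (fun i _ => star_mul_self_nonneg (f i))).1 h i hi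
  exact CStarRing.star_mul_self_eq_zero_iff _ |>.1 this

theorem exists_negPart {D : Type*} [CStarAlgebra D] (G : D) (hG : star G = G) :
    ∃ N Q : D, star N = N ∧ N * G * N = -(N * N * N) ∧ N * N * N = star Q * Q ∧
      (N = 0 → ∃ R : D, G = star R * R) := by
  let _ : PartialOrder D := CStarAlgebra.spectralOrder D
  have : StarOrderedRing D := CStarAlgebra.spectralOrderedRing D
  have hN0 : 0 ≤ G⁻ := CFC.negPart_nonneg G
  have hNs : star (G⁻) = G⁻ := (IsSelfAdjoint.of_nonneg hN0).star_eq
  have hp : 0 ≤ G⁻ * G⁻ * G⁻ := by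
    have := star_left_conjugate_nonneg hN0 (G⁻)
    rwa [hNs] at this
  obtain ⟨Q, hQ⟩ := CStarAlgebra.nonneg_iff_eq_star_mul_self.1 hp
  refine ⟨G⁻, Q, hNs, ?_, hQ, fun h => ?_⟩
  · have e : G⁻ * G = -(G⁻ * G⁻) := by
      calc G⁻ * G = G⁻ * (G⁺ - G⁻) := by rw [CFC.posPart_sub_negPart G hG]
        _ = _ := by rw [mul_sub, CFC.negPart_mul_posPart, zero_sub]
    rw [e, neg_mul]
  · exact CStarAlgebra.nonneg_iff_eq_star_mul_self.1
      (CStarAlgebra.nonneg_iff_isSelfAdjoint_and_negPart_eq_zero.2 ⟨hG, h⟩)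

theorem exists_matrix_factor {n : Type*} [Fintype n] [DecidableEq n] (G : CStarMatrix n n A)
    (hG : star G = G)
    (h : ∀ a : n → A, 0 ≤ ∑ i, ∑ j, a i * G i j * star (a j)) :
    ∃ R : CStarMatrix n n A, G = star R * R := by
  obtain ⟨N, Q, hNs, h3, hQ, hR⟩ := exists_negPart G hG
  refine hR ?_
  have hQ0 : Q = 0 := by
    ext l k
    have hd : (N * N * N) k k = ∑ l, star (Q l k) * Q l k := by
      rw [hQ, CStarMatrix.mul_apply]
      simp [CStarMatrix.star_apply]
    have h1 : 0 ≤ (N * G * N) k k := by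
      have e : (N * G * N) k k = ∑ i, ∑ j, N k i * G i j * star (N k j) := by
        rw [CStarMatrix.mul_apply, Finset.sum_comm]
        refine Finset.sum_congr rfl fun j _ => ?_
        rw [CStarMatrix.mul_apply, Finset.sum_mul]
        refine Finset.sum_congr rfl fun i _ => ?_
        congr 1
        rw [← CStarMatrix.star_apply, hNs]
      rw [e]; exact h (fun i => N k i)
    have h2 : 0 ≤ (N * N * N) k k := by
      rw [hd]; exact Finset.sum_nonneg fun i _ => star_mul_self_nonneg _
    have h4 : (N * N * N) k k = 0 := by
      rw [h3, CStarMatrix.neg_apply] at h1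
      exact le_antisymm (by simpa using h1) h2
    exact eq_zero_of_sum_star_mul_self Finset.univ (fun l => Q l k) (hd ▸ h4) l (Finset.mem_univ l)
  rw [hQ0, mul_zero] at hQ
  have h5 : star (N * N) * (N * N) = 0 := by
    rw [star_mul, hNs, ← mul_assoc, hQ, zero_mul]
  have h6 : star N * N = 0 := by
    rw [hNs]; exact (CStarRing.star_mul_self_eq_zero_iff _).1 h5
  exact (CStarRing.star_mul_self_eq_zero_iff _).1 h6

theorem exists_gram_factor {n : Type*} [Fintype n] [DecidableEq n] (x : n → E) :
    ∃ R : n → n → A, ∀ i j, inner A (x j) (x i) = ∑ k, star (R k i) * R k j := by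
  let G : CStarMatrix n n A := CStarMatrix.ofMatrix (fun i j => inner A (x j) (x i))
  have hGa : ∀ i j, G i j = inner A (x j) (x i) := fun _ _ => rfl
  obtain ⟨R, hR⟩ := exists_matrix_factor G
    (by ext i j; rw [CStarMatrix.star_apply, hGa, hGa, CStarModule.star_inner])
    (fun a => by
      have := CStarModule.inner_self_nonneg (A := A) (x := ∑ i, a i • x i)
      simp only [CStarModule.inner_sum_left, CStarModule.inner_sum_right,
        CStarModule.inner_op_smul_left, CStarModule.inner_op_smul_right] at this
      simpa only [hGa, Finset.mul_sum, mul_assoc] using this)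
  refine ⟨fun k i => R k i, fun i j => ?_⟩
  have := congrArg (fun P : CStarMatrix n n A => P i j) hR
  rw [← hGa]
  simpa [CStarMatrix.mul_apply, CStarMatrix.star_apply] using this

end Gram

/-! ### The algebraic tensor product of two Hilbert C⋆-modules -/

section PreInner

variable {A B M N : Type*} [CStarAlgebra A] [PartialOrder A] [StarOrderedRing A]
  [CStarAlgebra B] [PartialOrder B] [StarOrderedRing B]
  [NormedAddCommGroup M] [NormedSpace ℂ M] [Module A M] [IsScalarTower ℂ A M] [CStarModule A M]
  [NormedAddCommGroup N] [NormedSpace ℂ N] [Module B N] [IsScalarTower ℂ B N] [CStarModule B N]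

variable (A B M N) in
/-- The form with values in the algebraic tensor product `A ⊗ B` on the algebraic tensor product
`M ⊗ N` given by `⟨x ⊗ y, x' ⊗ y'⟩ = ⟨x, x'⟩ ⊗ ⟨y, y'⟩`. -/
def algInner : M ⊗[ℂ] N →ₗ⋆[ℂ] M ⊗[ℂ] N →ₗ[ℂ] A ⊗[ℂ] B :=
  (TensorProduct.homTensorHomMap (RingHom.id ℂ) M N A B).comp
    (TensorProduct.map (CStarModule.innerₛₗ (A := A) (E := M))
      (CStarModule.innerₛₗ (A := B) (E := N)))

theorem algInner_tmul (x x' : M) (y y' : N) :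
    algInner A B M N (x ⊗ₜ y) (x' ⊗ₜ y') = inner A x x' ⊗ₜ inner B y y' := rfl

variable (A B M N) in
/-- The action `(a ⊗ b) (x ⊗ y) = a x ⊗ b y` of the algebraic tensor product `A ⊗ B` on the
algebraic tensor product `M ⊗ N`. -/
def algAct : A ⊗[ℂ] B →ₐ[ℂ] Module.End ℂ (M ⊗[ℂ] N) :=
  (Module.endTensorEndAlgHom (R := ℂ) (A := ℂ) (M := M) (N := N)).comp
    (Algebra.TensorProduct.map (Algebra.lsmul ℂ ℂ M) (Algebra.lsmul ℂ ℂ N))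

theorem algAct_tmul (a : A) (b : B) (x : M) (y : N) :
    algAct A B M N (a ⊗ₜ b) (x ⊗ₜ y) = (a • x) ⊗ₜ (b • y) := rfl

theorem star_algInner (z w : M ⊗[ℂ] N) :
    star (algInner A B M N z w) = algInner A B M N w z := by
  induction z using TensorProduct.induction_on with
  | zero => simp
  | add z z' h h' => simp [h, h']
  | tmul x y =>
    induction w using TensorProduct.induction_on with
    | zero => simp
    | add z z' h h' => simp [h, h']
    | tmul x' y' => simp [algInner_tmul]

theorem algInner_act (t : A ⊗[ℂ] B) (z w : M ⊗[ℂ] N) :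
    algInner A B M N z (algAct A B M N t w) = t * algInner A B M N z w := by
  induction t using TensorProduct.induction_on with
  | zero => simp
  | add t t' h h' => simp [h, h', add_mul]
  | tmul a b =>
    induction z using TensorProduct.induction_on with
    | zero => simp
    | add z z' h h' => simp [h, h', mul_add]
    | tmul x y =>
      induction w using TensorProduct.induction_on with
      | zero => simp
      | add z z' h h' => simp [h, h', mul_add]
      | tmul x' y' => simp [algInner_tmul, algAct_tmul]

theorem algInner_self (z : M ⊗[ℂ] N) : ∃ (n : ℕ) (u : Fin n × Fin n → A ⊗[ℂ] B),
    algInner A B M N z z = ∑ p, star (u p) * u p := by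
  obtain ⟨n, x, y, rfl⟩ := TensorProduct.exists_sum_tmul_eq z
  obtain ⟨R, hR⟩ := exists_gram_factor (A := A) x
  obtain ⟨T, hT⟩ := exists_gram_factor (A := B) y
  refine ⟨n, fun p => ∑ i, R p.1 i ⊗ₜ T p.2 i, ?_⟩
  have hL : algInner A B M N (∑ i, x i ⊗ₜ y i) (∑ i, x i ⊗ₜ y i) =
      ∑ i, ∑ j, ∑ k, ∑ l, (star (R k j) * R k i) ⊗ₜ[ℂ] (star (T l j) * T l i) := by
    rw [map_sum, Finset.sum_comm]
    simp only [map_sum, LinearMap.sum_apply, algInner_tmul, hR, hT, TensorProduct.sum_tmul,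
      TensorProduct.tmul_sum]
    exact Finset.sum_congr rfl fun i _ => Finset.sum_congr rfl fun j _ => Finset.sum_comm
  have hS : ∀ k l, star (∑ i, R k i ⊗ₜ[ℂ] T l i) * (∑ i, R k i ⊗ₜ[ℂ] T l i) =
      ∑ i, ∑ j, (star (R k j) * R k i) ⊗ₜ[ℂ] (star (T l j) * T l i) := by
    intro k l
    rw [star_sum, Finset.sum_mul_sum, Finset.sum_comm]
    simp only [TensorProduct.star_tmul, Algebra.TensorProduct.tmul_mul_tmul]
  rw [hL, Fintype.sum_prod_type]
  simp only [hS]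
  calc _ = ∑ i, ∑ k, ∑ l, ∑ j, (star (R k j) * R k i) ⊗ₜ[ℂ] (star (T l j) * T l i) := by
        refine Finset.sum_congr rfl fun i _ => ?_
        rw [Finset.sum_comm]
        exact Finset.sum_congr rfl fun k _ => Finset.sum_comm
    _ = _ := by
        rw [Finset.sum_comm]
        exact Finset.sum_congr rfl fun k _ => Finset.sum_comm

end PreInner
/-! ### The exterior tensor product of two Hilbert C⋆-modules -/

section Exterior

variable {A B H K : Type*} [CStarAlgebra A] [PartialOrder A] [StarOrderedRing A]
  [CStarAlgebra B] [PartialOrder B] [StarOrderedRing B]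
  [NormedAddCommGroup H] [InnerProductSpace ℂ H] [CompleteSpace H]
  [NormedAddCommGroup K] [InnerProductSpace ℂ K] [CompleteSpace K]
  (π : A →⋆ₐ[ℂ] (H →L[ℂ] H)) (ρ : B →⋆ₐ[ℂ] (K →L[ℂ] K))
  (M N : Type*)
  [NormedAddCommGroup M] [NormedSpace ℂ M] [Module A M] [IsScalarTower ℂ A M] [CStarModule A M]
  [NormedAddCommGroup N] [NormedSpace ℂ N] [Module B N] [IsScalarTower ℂ B N] [CStarModule B N]

/-- The algebraic tensor product `M ⊗ N`, to be normed by the `A ⊗ B`-valued inner product. -/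
def PreExt (_π : A →⋆ₐ[ℂ] (H →L[ℂ] H)) (_ρ : B →⋆ₐ[ℂ] (K →L[ℂ] K)) : Type _ := M ⊗[ℂ] N

instance : AddCommGroup (PreExt M N π ρ) := inferInstanceAs (AddCommGroup (M ⊗[ℂ] N))
instance : Module ℂ (PreExt M N π ρ) := inferInstanceAs (Module ℂ (M ⊗[ℂ] N))

/-- The semi-inner product on the algebraic tensor product, with values in `A ⊗ B`. -/
def preInner : PreExt M N π ρ →ₗ⋆[ℂ] PreExt M N π ρ →ₗ[ℂ] SpatialTensor π ρ :=
  (algInner A B M N).compr₂ₛₗ (spatialMk π ρ).toAlgHom.toLinearMap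

/-- The action of the algebraic tensor product `A ⊗ B` on the algebraic tensor product `M ⊗ N`. -/
def preAct : A ⊗[ℂ] B →ₐ[ℂ] Module.End ℂ (PreExt M N π ρ) := algAct A B M N

variable {π ρ M N}

theorem preInner_apply (z w : PreExt M N π ρ) :
    preInner π ρ M N z w = spatialMk π ρ (algInner A B M N z w) := rfl

theorem star_preInner (z w : PreExt M N π ρ) :
    star (preInner π ρ M N z w) = preInner π ρ M N w z := by
  rw [preInner_apply, ← map_star]
  exact congrArg _ (star_algInner (A := A) (B := B) (M := M) (N := N) z w)

theorem preInner_smul_right (c : ℂ) (z w : PreExt M N π ρ) :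
    preInner π ρ M N z (c • w) = c • preInner π ρ M N z w :=
  LinearMap.map_smul _ c w

theorem preInner_smul_left (c : ℂ) (z w : PreExt M N π ρ) :
    preInner π ρ M N (c • z) w = star c • preInner π ρ M N z w := by
  rw [← star_preInner, preInner_smul_right, star_smul, star_preInner]

theorem preInner_act_right (t : A ⊗[ℂ] B) (z w : PreExt M N π ρ) :
    preInner π ρ M N z (preAct π ρ M N t w) = spatialMk π ρ t * preInner π ρ M N z w := by
  rw [preInner_apply, preInner_apply, ← map_mul]
  exact congrArg _ (algInner_act t z w)

theorem preInner_act_left (t : A ⊗[ℂ] B) (z w : PreExt M N π ρ) :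
    preInner π ρ M N (preAct π ρ M N t z) w = preInner π ρ M N z w * star (spatialMk π ρ t) := by
  rw [← star_preInner, preInner_act_right, star_mul, star_preInner]

theorem preInner_self_nonneg (z : PreExt M N π ρ) : 0 ≤ preInner π ρ M N z z := by
  obtain ⟨n, u, hu⟩ := algInner_self (A := A) (B := B) (M := M) (N := N) z
  rw [preInner_apply, hu, map_sum]
  refine Finset.sum_nonneg fun p _ => ?_
  rw [map_mul, map_star]
  exact star_mul_self_nonneg _

theorem norm_preInner_sq_le (z w : PreExt M N π ρ) :
    ‖preInner π ρ M N z w‖ ^ 2 ≤ ‖preInner π ρ M N z z‖ * ‖preInner π ρ M N w w‖ := by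
  have key : ∀ s : ℝ, ‖preInner π ρ M N z z‖ < s →
      ‖preInner π ρ M N z w‖ ^ 2 ≤ s * ‖preInner π ρ M N w w‖ := by
    intro s hs
    have hs0 : 0 < s := (norm_nonneg _).trans_lt hs
    set a := preInner π ρ M N z w with ha
    obtain ⟨t, hj⟩ : ∃ t : A ⊗[ℂ] B, spatialMk π ρ t = a := ⟨algInner A B M N z w, rfl⟩
    have h0 := preInner_self_nonneg
      (preAct π ρ M N t z - (s : ℂ) • w)
    have e : preInner π ρ M N (preAct π ρ M N t z - (s : ℂ) • w)
        (preAct π ρ M N t z - (s : ℂ) • w) =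
        a * preInner π ρ M N z z * star a - (2 * s) • (a * star a)
          + s • s • preInner π ρ M N w w := by
      have h1 : preInner π ρ M N w z = star a := by rw [ha, star_preInner]
      have h2 : ∀ c : SpatialTensor π ρ, ((s : ℂ)) • c = s • c := fun c => Complex.coe_smul s c
      have h3 : star (s : ℂ) = s := Complex.conj_ofReal s
      rw [map_sub, map_sub, LinearMap.sub_apply, LinearMap.sub_apply]
      simp only [preInner_act_left, preInner_act_right, hj,
        preInner_smul_left, preInner_smul_right, h1, h2, h3]
      rw [two_mul, add_smul]
      simp only [mul_smul_comm, ← ha, mul_assoc]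
      abel
    rw [e] at h0
    have h2 : a * preInner π ρ M N z z * star a ≤ s • (a * star a) := by
      refine (CStarAlgebra.star_right_conjugate_le_norm_smul
        (hb := .of_nonneg (preInner_self_nonneg z))).trans ?_
      exact smul_le_smul_of_nonneg_right hs.le (mul_star_self_nonneg a)
    have h3 : s • (a * star a) ≤ s • s • preInner π ρ M N w w := by
      have := h0.trans (add_le_add_left (sub_le_sub_right h2 _) _)
      rw [two_mul, add_smul] at this
      rw [← sub_nonneg]
      refine this.trans_eq ?_
      abel
    have h4 : a * star a ≤ s • preInner π ρ M N w w :=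
      (smul_le_smul_iff_of_pos_left hs0).1 h3
    have h5 := CStarAlgebra.norm_le_norm_of_nonneg_of_le (mul_star_self_nonneg a) h4
    rw [CStarRing.norm_self_mul_star, ← sq, norm_smul, Real.norm_of_nonneg hs0.le] at h5
    exact h5
  refine le_of_forall_pos_le_add fun ε hε => ?_
  have h6 := key (‖preInner π ρ M N z z‖ + ε / (‖preInner π ρ M N w w‖ + 1))
    (by have : 0 < ε / (‖preInner π ρ M N w w‖ + 1) := by positivity
        linarith)
  refine h6.trans ?_
  rw [add_mul]
  have h7 : ε / (‖preInner π ρ M N w w‖ + 1) * ‖preInner π ρ M N w w‖ ≤ ε := by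
    rw [div_mul_eq_mul_div, div_le_iff₀ (by positivity)]
    nlinarith [norm_nonneg (preInner π ρ M N w w)]
  linarith

instance : Norm (PreExt M N π ρ) where
  norm z := √‖preInner π ρ M N z z‖

theorem pre_norm_def (z : PreExt M N π ρ) : ‖z‖ = √‖preInner π ρ M N z z‖ := rfl

theorem pre_norm_sq (z : PreExt M N π ρ) : ‖z‖ ^ 2 = ‖preInner π ρ M N z z‖ :=
  Real.sq_sqrt (norm_nonneg _)

theorem norm_preInner_le (z w : PreExt M N π ρ) : ‖preInner π ρ M N z w‖ ≤ ‖z‖ * ‖w‖ := by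
  refine abs_le_of_sq_le_sq' ?_ (mul_nonneg (Real.sqrt_nonneg _) (Real.sqrt_nonneg _)) |>.2
  rw [mul_pow]
  refine le_of_le_of_eq ?_ (congrArg₂ (· * ·) (pre_norm_sq z).symm (pre_norm_sq w).symm)
  exact norm_preInner_sq_le z w

theorem preExtCore : SeminormedSpace.Core ℂ (PreExt M N π ρ) where
  norm_nonneg z := Real.sqrt_nonneg _
  norm_smul c z := by
    rw [pre_norm_def, pre_norm_def, preInner_smul_left, preInner_smul_right,
      norm_smul, norm_smul, norm_star, ← mul_assoc, Real.sqrt_mul (by positivity),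
      Real.sqrt_mul_self (norm_nonneg _)]
  norm_triangle z w := by
    refine abs_le_of_sq_le_sq' ?_ (add_nonneg (Real.sqrt_nonneg _) (Real.sqrt_nonneg _)) |>.2
    refine (pre_norm_sq (z + w)).trans_le ?_
    rw [map_add, map_add, LinearMap.add_apply, LinearMap.add_apply]
    have h1 := norm_preInner_le z w
    have h2 := norm_preInner_le w z
    have h3 := norm_add₃_le (a := preInner π ρ M N z z + preInner π ρ M N w z)
      (b := preInner π ρ M N z w) (c := preInner π ρ M N w w)
    have h4 := norm_add_le (preInner π ρ M N z z) (preInner π ρ M N w z)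
    rw [add_assoc] at h3
    have h5 := pre_norm_sq z
    have h6 := pre_norm_sq w
    rw [add_sq]
    change _ ≤ ‖z‖ ^ 2 + 2 * ‖z‖ * ‖w‖ + ‖w‖ ^ 2
    linarith [mul_comm ‖w‖ ‖z‖]

instance : SeminormedAddCommGroup (PreExt M N π ρ) :=
  SeminormedAddCommGroup.ofCore (𝕜 := ℂ) preExtCore

instance : NormedSpace ℂ (PreExt M N π ρ) where
  norm_smul_le c z := (preExtCore.norm_smul c z).le

variable (π ρ M N) in
/-- The semi-inner product as a bounded sesquilinear map. -/
def preInnerSL : PreExt M N π ρ →L⋆[ℂ] PreExt M N π ρ →L[ℂ] SpatialTensor π ρ :=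
  LinearMap.mkContinuous₂ (preInner π ρ M N) 1 fun z w => by
    rw [one_mul]; exact norm_preInner_le z w

theorem preInnerSL_apply (z w : PreExt M N π ρ) :
    preInnerSL π ρ M N z w = preInner π ρ M N z w := rfl

theorem norm_preAct_le (t : A ⊗[ℂ] B) (z : PreExt M N π ρ) :
    ‖preAct π ρ M N t z‖ ≤ ‖spatialMk π ρ t‖ * ‖z‖ := by
  refine abs_le_of_sq_le_sq' ?_ (by positivity) |>.2
  rw [pre_norm_sq, preInner_act_left, preInner_act_right, mul_pow, pre_norm_sq]
  refine (norm_mul_le _ _).trans ?_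
  rw [norm_star]
  have := norm_mul_le (spatialMk π ρ t) (preInner π ρ M N z z)
  nlinarith [norm_nonneg (spatialMk π ρ t)]

variable (π ρ M N) in
/-- The exterior tensor product `M ⊗ N`: the completion of the algebraic tensor product for the
norm `‖z‖ = ‖⟨z, z⟩‖ ^ (1 / 2)`. It is a Hilbert module over `SpatialTensor π ρ`, by the
instances below. -/
def ExtTensorProduct : Type _ := UniformSpace.Completion (PreExt M N π ρ)

instance : NormedAddCommGroup (ExtTensorProduct π ρ M N) :=
  inferInstanceAs (NormedAddCommGroup (UniformSpace.Completion (PreExt M N π ρ)))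

instance : NormedSpace ℂ (ExtTensorProduct π ρ M N) :=
  inferInstanceAs (NormedSpace ℂ (UniformSpace.Completion (PreExt M N π ρ)))

instance : CompleteSpace (ExtTensorProduct π ρ M N) :=
  inferInstanceAs (CompleteSpace (UniformSpace.Completion (PreExt M N π ρ)))

variable (π ρ M N) in
/-- The canonical map from the algebraic to the exterior tensor product of `M` and `N`. -/
def extMk : PreExt M N π ρ →L[ℂ] ExtTensorProduct π ρ M N :=
  (UniformSpace.Completion.toComplL (𝕜 := ℂ) (E := PreExt M N π ρ))

theorem norm_extMk (z : PreExt M N π ρ) : ‖extMk π ρ M N z‖ = ‖z‖ :=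
  UniformSpace.Completion.norm_coe z

theorem denseRange_extMk : DenseRange (extMk π ρ M N) :=
  UniformSpace.Completion.denseRange_coe

theorem ext_induction {p : ExtTensorProduct π ρ M N → Prop} (hc : IsClosed {x | p x})
    (h : ∀ z, p (extMk π ρ M N z)) (x : ExtTensorProduct π ρ M N) : p x :=
  denseRange_extMk.induction_on x hc h

theorem ext_clm {F : Type*} [NormedAddCommGroup F] [NormedSpace ℂ F] {σ : ℂ →+* ℂ}
    {f g : ExtTensorProduct π ρ M N →SL[σ] F} (h : ∀ z, f (extMk π ρ M N z) = g (extMk π ρ M N z)) :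
    f = g := by
  ext x
  exact ext_induction (isClosed_eq f.continuous g.continuous) h x

variable (π ρ M N) in
/-- The inner product with a fixed element of the algebraic tensor product. -/
def extInnerAux (z : PreExt M N π ρ) : ExtTensorProduct π ρ M N →L[ℂ] SpatialTensor π ρ :=
  (preInnerSL π ρ M N z).toLinearMap.extendOfNorm (extMk π ρ M N).toLinearMap

theorem extInnerAux_mk (z w : PreExt M N π ρ) :
    extInnerAux π ρ M N z (extMk π ρ M N w) = preInner π ρ M N z w := by
  refine LinearMap.extendOfNorm_eq denseRange_extMk ⟨‖z‖, fun x => ?_⟩ w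
  exact (norm_preInner_le z x).trans_eq (congrArg _ (norm_extMk x).symm)

theorem norm_extInnerAux_le (z : PreExt M N π ρ) : ‖extInnerAux π ρ M N z‖ ≤ ‖z‖ := by
  refine LinearMap.opNorm_extendOfNorm_le denseRange_extMk (norm_nonneg z) fun x => ?_
  exact (norm_preInner_le z x).trans_eq (congrArg _ (norm_extMk x).symm)

variable (π ρ M N) in
/-- The `A ⊗ B`-valued inner product on the exterior tensor product. -/
def extInner : ExtTensorProduct π ρ M N →L⋆[ℂ] ExtTensorProduct π ρ M N →L[ℂ] SpatialTensor π ρ :=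
  LinearMap.extendOfNorm
    ({ toFun := extInnerAux π ρ M N
       map_add' := fun z z' => ext_clm fun w => by
        simp only [add_apply, extInnerAux_mk, map_add, LinearMap.add_apply]
       map_smul' := fun c z => ext_clm fun w => by
        rw [smul_apply, extInnerAux_mk, extInnerAux_mk, preInner_smul_left]
        rfl } : PreExt M N π ρ →ₗ⋆[ℂ] ExtTensorProduct π ρ M N →L[ℂ] SpatialTensor π ρ)
    (extMk π ρ M N).toLinearMap

theorem extInner_mk (z w : PreExt M N π ρ) :
    extInner π ρ M N (extMk π ρ M N z) (extMk π ρ M N w) = preInner π ρ M N z w := by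
  rw [← extInnerAux_mk]
  refine DFunLike.congr_fun (LinearMap.extendOfNorm_eq denseRange_extMk ⟨1, fun x => ?_⟩ z) _
  rw [one_mul]
  exact (norm_extInnerAux_le x).trans_eq (norm_extMk x).symm

variable (π ρ M N) in
/-- The action of the algebraic tensor product `A ⊗ B` on the exterior tensor product. -/
def extActAux (t : A ⊗[ℂ] B) : ExtTensorProduct π ρ M N →L[ℂ] ExtTensorProduct π ρ M N :=
  ((extMk π ρ M N).toLinearMap ∘ₗ preAct π ρ M N t).extendOfNorm (extMk π ρ M N).toLinearMap

theorem extActAux_bound (t : A ⊗[ℂ] B) (z : PreExt M N π ρ) :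
    ‖extMk π ρ M N (preAct π ρ M N t z)‖ ≤ ‖spatialMk π ρ t‖ * ‖extMk π ρ M N z‖ := by
  rw [norm_extMk, norm_extMk]
  exact norm_preAct_le t z

theorem extActAux_mk (t : A ⊗[ℂ] B) (z : PreExt M N π ρ) :
    extActAux π ρ M N t (extMk π ρ M N z) = extMk π ρ M N (preAct π ρ M N t z) :=
  LinearMap.extendOfNorm_eq denseRange_extMk ⟨_, extActAux_bound t⟩ z

theorem norm_extActAux_le (t : A ⊗[ℂ] B) : ‖extActAux π ρ M N t‖ ≤ ‖spatialMk π ρ t‖ :=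
  LinearMap.opNorm_extendOfNorm_le denseRange_extMk (norm_nonneg _) (extActAux_bound t)

variable (π ρ M N) in
/-- The action of `A ⊗ B` on the exterior tensor product as a bounded linear map. -/
def extActL : SpatialTensor π ρ →L[ℂ]
    ExtTensorProduct π ρ M N →L[ℂ] ExtTensorProduct π ρ M N :=
  LinearMap.extendOfNorm
    ({ toFun := extActAux π ρ M N
       map_add' := fun t t' => ext_clm fun w => by
        simp only [add_apply, extActAux_mk, map_add, LinearMap.add_apply]
       map_smul' := fun c t => ext_clm fun w => by
        simp only [smul_apply, extActAux_mk, map_smul, LinearMap.smul_apply,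
          RingHom.id_apply] } :
      A ⊗[ℂ] B →ₗ[ℂ] ExtTensorProduct π ρ M N →L[ℂ] ExtTensorProduct π ρ M N)
    (spatialMk π ρ).toAlgHom.toLinearMap

theorem extActL_mk (t : A ⊗[ℂ] B) : extActL π ρ M N (spatialMk π ρ t) = extActAux π ρ M N t := by
  refine LinearMap.extendOfNorm_eq (e := (spatialMk π ρ).toAlgHom.toLinearMap)
    (denseRange_spatialMk π ρ) ⟨1, fun x => ?_⟩ t
  rw [one_mul]
  exact norm_extActAux_le x

theorem extActL_mk_mk (t : A ⊗[ℂ] B) (z : PreExt M N π ρ) :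
    extActL π ρ M N (spatialMk π ρ t) (extMk π ρ M N z) = extMk π ρ M N (preAct π ρ M N t z) := by
  rw [extActL_mk, extActAux_mk]

theorem spatial_induction {p : SpatialTensor π ρ → Prop} (hc : IsClosed {c | p c})
    (h : ∀ t, p (spatialMk π ρ t)) (c : SpatialTensor π ρ) : p c :=
  (denseRange_spatialMk π ρ).induction_on c hc h

variable (π ρ M N) in
/-- The action of `A ⊗ B` on the exterior tensor product as a ring homomorphism. -/
def extAct : SpatialTensor π ρ →+* (ExtTensorProduct π ρ M N →L[ℂ] ExtTensorProduct π ρ M N) where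
  toFun := extActL π ρ M N
  map_zero' := map_zero _
  map_add' := map_add _
  map_one' := ext_clm fun z => by
    rw [← map_one (spatialMk π ρ), extActL_mk_mk, map_one]; rfl
  map_mul' c d := by
    refine spatial_induction (p := fun c => extActL π ρ M N (c * d) =
      extActL π ρ M N c * extActL π ρ M N d) (isClosed_eq (by fun_prop) (by fun_prop)) ?_ c
    intro t
    refine spatial_induction (p := fun d => extActL π ρ M N (spatialMk π ρ t * d) =
      extActL π ρ M N (spatialMk π ρ t) * extActL π ρ M N d)
      (isClosed_eq (by fun_prop) (by fun_prop)) ?_ d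
    intro s
    refine ext_clm fun z => ?_
    rw [← map_mul, extActL_mk_mk, mul_apply_eq_comp, extActL_mk_mk, extActL_mk_mk,
      map_mul]
    rfl

instance : Module (SpatialTensor π ρ) (ExtTensorProduct π ρ M N) :=
  Module.compHom _ (extAct π ρ M N)

theorem ext_smul_def (c : SpatialTensor π ρ) (x : ExtTensorProduct π ρ M N) :
    c • x = extActL π ρ M N c x := rfl

instance : IsScalarTower ℂ (SpatialTensor π ρ) (ExtTensorProduct π ρ M N) where
  smul_assoc z c x := by
    rw [ext_smul_def, ext_smul_def, map_smul, smul_apply]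

theorem star_extInner (x y : ExtTensorProduct π ρ M N) :
    star (extInner π ρ M N x y) = extInner π ρ M N y x := by
  refine ext_induction (p := fun x => star (extInner π ρ M N x y) = extInner π ρ M N y x)
    (isClosed_eq (by fun_prop) (by fun_prop)) (fun z => ?_) x
  refine ext_induction (p := fun y => star (extInner π ρ M N (extMk π ρ M N z) y) =
    extInner π ρ M N y (extMk π ρ M N z)) (isClosed_eq (by fun_prop) (by fun_prop)) (fun w => ?_) y
  rw [extInner_mk, extInner_mk, star_preInner]

theorem extInner_smul_right (c : SpatialTensor π ρ) (x y : ExtTensorProduct π ρ M N) :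
    extInner π ρ M N x (c • y) = c * extInner π ρ M N x y := by
  simp only [ext_smul_def]
  refine spatial_induction (p := fun c => extInner π ρ M N x (extActL π ρ M N c y) =
    c * extInner π ρ M N x y) (isClosed_eq (by fun_prop) (by fun_prop)) (fun t => ?_) c
  refine ext_induction (p := fun x => extInner π ρ M N x (extActL π ρ M N (spatialMk π ρ t) y) =
    spatialMk π ρ t * extInner π ρ M N x y) (isClosed_eq (by fun_prop) (by fun_prop))
    (fun z => ?_) x
  refine ext_induction (p := fun y => extInner π ρ M N (extMk π ρ M N z)
    (extActL π ρ M N (spatialMk π ρ t) y) = spatialMk π ρ t * extInner π ρ M N (extMk π ρ M N z) y)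
    (isClosed_eq (by fun_prop) (by fun_prop)) (fun w => ?_) y
  rw [extActL_mk_mk, extInner_mk, extInner_mk, preInner_act_right]

theorem extInner_self_nonneg (x : ExtTensorProduct π ρ M N) : 0 ≤ extInner π ρ M N x x := by
  refine ext_induction (p := fun x => 0 ≤ extInner π ρ M N x x)
    (isClosed_le (by fun_prop) (by fun_prop)) (fun z => ?_) x
  rw [extInner_mk]
  exact preInner_self_nonneg z

theorem ext_norm_eq (x : ExtTensorProduct π ρ M N) : ‖x‖ = √‖extInner π ρ M N x x‖ := by
  refine ext_induction (p := fun x => ‖x‖ = √‖extInner π ρ M N x x‖)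
    (isClosed_eq (by fun_prop) (by fun_prop)) (fun z => ?_) x
  rw [extInner_mk, norm_extMk, pre_norm_def]

instance : CStarModule (SpatialTensor π ρ) (ExtTensorProduct π ρ M N) where
  inner x y := extInner π ρ M N x y
  inner_add_right := map_add _ _ _
  inner_self_nonneg := extInner_self_nonneg _
  inner_self {x} := by
    refine ⟨fun h => ?_, fun h => by rw [h, map_zero]⟩
    rw [← norm_eq_zero, ext_norm_eq, h, norm_zero, Real.sqrt_zero]
  inner_op_smul_right := extInner_smul_right _ _ _
  inner_smul_right_complex := map_smul _ _ _
  star_inner := star_extInner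
  norm_eq_sqrt_norm_inner_self := ext_norm_eq

variable (π ρ) in
/-- The elementary tensor `x ⊗ y` in the exterior tensor product. -/
def etmul (x : M) (y : N) : ExtTensorProduct π ρ M N :=
  extMk π ρ M N (x ⊗ₜ[ℂ] y : M ⊗[ℂ] N)

variable (π ρ) in
/-- The elementary tensor `a ⊗ b` in the spatial tensor product. -/
def stmul (a : A) (b : B) : SpatialTensor π ρ := spatialMk π ρ (a ⊗ₜ[ℂ] b)

theorem inner_etmul (x x' : M) (y y' : N) :
    inner (SpatialTensor π ρ) (etmul π ρ x y) (etmul π ρ x' y') =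
      stmul π ρ (inner A x x') (inner B y y') := extInner_mk _ _

theorem stmul_smul_etmul (a : A) (b : B) (x : M) (y : N) :
    stmul π ρ a b • etmul π ρ x y = etmul π ρ (a • x) (b • y) := extActL_mk_mk _ _

variable (π ρ M N) in
/-- The set of elementary tensors `f ⊗ g` in the exterior tensor product. -/
def elementaryTensors : Set (ExtTensorProduct π ρ M N) :=
  {z | ∃ (f : M) (g : N), z = etmul π ρ f g}

variable (π ρ) in
/-- The map `(ω₁, ω₂) ↦ X₁ ω₁ ⊗ X₂ ω₂`. -/
def tensorMap {Ω₁ Ω₂ : Type*} (X₁ : Ω₁ → M) (X₂ : Ω₂ → N) :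
    Ω₁ × Ω₂ → ExtTensorProduct π ρ M N :=
  fun ω => etmul π ρ (X₁ ω.1) (X₂ ω.2)

end Exterior

/-! ### Continuous biframes and biframe operators -/

/-- The inner product of a left Hilbert module over `A`, which is linear in the first variable:
`⟪a • x, y⟫ₗ[A] = a * ⟪x, y⟫ₗ[A]`. The field `inner` of Mathlib's `CStarModule` satisfies
`inner A x (a • y) = a * inner A x y`, so that the two arguments are exchanged. -/
notation "⟪" x ", " y "⟫ₗ[" A "]" => Inner.inner A y x

section Biframe

variable (A : Type*) {E Ω : Type*} [CStarAlgebra A] [PartialOrder A]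
  [NormedAddCommGroup E] [NormedSpace ℂ E] [Module A E] [CStarModule A E] [MeasurableSpace Ω]

/-- `(X, Y)` is a continuous biframe with respect to `(Ω, μ)` with bounds `a` and `b`, where the
conditions are required for all `f` in `T`. For a Hilbert module, `T` is the whole module; for the
exterior tensor product of two Hilbert modules, `T` is the set of elementary tensors. -/
structure IsContinuousBiframeOn (T : Set E) (μ : Measure Ω) (X Y : Ω → E) (a b : ℝ) : Prop where
  pos : 0 < a
  le : a ≤ b
  measurable_left : ∀ f ∈ T, AEStronglyMeasurable (fun ω => ⟪f, X ω⟫ₗ[A]) μ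
  measurable_right : ∀ f ∈ T, AEStronglyMeasurable (fun ω => ⟪f, Y ω⟫ₗ[A]) μ
  integrable : ∀ f ∈ T, Integrable (fun ω => ⟪f, X ω⟫ₗ[A] * ⟪Y ω, f⟫ₗ[A]) μ
  lower_bound : ∀ f ∈ T, a • ⟪f, f⟫ₗ[A] ≤ ∫ ω, ⟪f, X ω⟫ₗ[A] * ⟪Y ω, f⟫ₗ[A] ∂μ
  upper_bound : ∀ f ∈ T, ∫ ω, ⟪f, X ω⟫ₗ[A] * ⟪Y ω, f⟫ₗ[A] ∂μ ≤ b • ⟪f, f⟫ₗ[A]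

/-- `S f = ∫ ⟪f, X ω⟫ Y ω dμ` for all `f` in `T`, where the integral is taken weakly, that is,
after pairing with the elements `g` of `T`. As for biframes, `T` is the whole module, or the set of
elementary tensors. If `ω ↦ ⟪f, X ω⟫ • Y ω` is Bochner integrable, then its Bochner integral
has the property required of `S f`. -/
def IsBiframeOperatorOn (T : Set E) (μ : Measure Ω) (X Y : Ω → E) (S : E → E) : Prop :=
  ∀ f ∈ T, ∀ g ∈ T, Integrable (fun ω => ⟪f, X ω⟫ₗ[A] * ⟪Y ω, g⟫ₗ[A]) μ ∧
    ⟪S f, g⟫ₗ[A] = ∫ ω, ⟪f, X ω⟫ₗ[A] * ⟪Y ω, g⟫ₗ[A] ∂μ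

variable (E) in
/-- The algebra of adjointable operators on the Hilbert module `E`. -/
def adjointableOperators : Subalgebra ℂ (E →L[ℂ] E) where
  carrier := {S | ∃ S' : E →L[ℂ] E, ∀ x y : E, ⟪S x, y⟫ₗ[A] = ⟪x, S' y⟫ₗ[A]}
  mul_mem' := by
    rintro S T ⟨S', hS⟩ ⟨T', hT⟩
    exact ⟨T' * S', fun x y => (hS (T x) y).trans (hT x (S' y))⟩
  add_mem' := by
    rintro S T ⟨S', hS⟩ ⟨T', hT⟩
    refine ⟨S' + T', fun x y => ?_⟩
    have h1 := hS x y
    have h2 := hT x y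
    simp only [add_apply, CStarModule.inner_add_left, CStarModule.inner_add_right, h1, h2]
  algebraMap_mem' c := by
    refine ⟨algebraMap ℂ (E →L[ℂ] E) (star c), fun x y => ?_⟩
    have h : ∀ (c : ℂ) (x : E), algebraMap ℂ (E →L[ℂ] E) c x = c • x := fun c x => by
      rw [Algebra.algebraMap_eq_smul_one]; rfl
    rw [h, h, CStarModule.inner_smul_right_complex, CStarModule.inner_smul_left_complex, star_star]

/-- The order on operators on a Hilbert module: `S ≤ T` if `⟪S x, x⟫ ≤ ⟪T x, x⟫` for all `x`. -/
def OperatorLE (S T : E →L[ℂ] E) : Prop := ∀ x : E, ⟪S x, x⟫ₗ[A] ≤ ⟪T x, x⟫ₗ[A]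

end Biframe

end

end TensorBiframe

open TensorBiframe

/-! ### Bilinear integrands on product measures without σ-finiteness -/

section ProductMeasure

variable {Ω₁ Ω₂ : Type*} [MeasurableSpace Ω₁] [MeasurableSpace Ω₂]
  {μ₁ : Measure Ω₁} {μ₂ : Measure Ω₂} {μ : Measure (Ω₁ × Ω₂)}

/-! The biframe operator of the tensor pair is the extension of `S₁ ⊗ S₂`, and four facts make this
work.

Factors. `S₁` and `S₂` are given only by weak identities, tested on the whole module; this already
makes them linear, and the biframe inequalities say `a ≤ S₁ ≤ b` and `c ≤ S₂ ≤ d` as quadratic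
forms. Positive elements are self-adjoint, so polarization makes both operators symmetric
(`exists_symmetric_linearMap_of_isContinuousBiframeOn`) and therefore linear over the C⋆-algebra
(`map_smul_of_symmetric`).

Tensor product. For positive `T` and `P` the matrices `⟨T xᵢ, xⱼ⟩` and `⟨P yᵢ, yⱼ⟩` are of the form
`R⋆R`. Hence `T ⊗ P` has a quadratic form that is a sum of squares already in the algebraic tensor
product (`algInner_map_self`). Changing one factor at a time turns this positivity into `ac ≤ S₁ ⊗
S₂ ≤ bd`. A symmetric `U` with `-k ≤ U ≤ k` satisfies `U² ≤ k²`, so it is bounded and extends to the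
completion with the same bounds (`exists_extension_of_symmetric`).

Integrals. A product measure need not be unique without σ-finiteness, but an integrable function
lives on a σ-finite set, and on rectangles of such sets it is unique. So a bounded bilinear map of
two integrable functions is integrable and its integral factorizes
(`integrable_and_integral_bilin_of_prod`). For `(a, b) ↦ a ⊗ b` this gives the biframe inequalities
and the weak formula for `S`; for `(x, y) ↦ x ⊗ y` it gives the Bochner integral. Uniqueness holds
because elementary tensors span a dense subspace.

Spectrum. A symmetric `V` with `0 < m ≤ V ≤ k` is inverted by a Neumann series, with symmetric
inverse (`exists_symmetric_inverse`). This applies to `S`, to `±(S - t)` for real `t` outside the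
interval, and to `(z - S)(z̄ - S)` for non-real `z`. -/

theorem quasiMeasurePreserving_fst_of_prod
    (hμ : ∀ s t, MeasurableSet s → MeasurableSet t → μ (s ×ˢ t) = μ₁ s * μ₂ t) :
    Measure.QuasiMeasurePreserving Prod.fst μ μ₁ := by
  refine ⟨measurable_fst, Measure.AbsolutelyContinuous.mk fun s hs h0 => ?_⟩
  rw [Measure.map_apply measurable_fst hs, ← Set.prod_univ, hμ _ _ hs .univ, h0, zero_mul]

/-- A strip over a null set has measure `μ₁ univ * 0`, which is `0` even if `μ₁ univ = ∞`. So null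
sets pull back to null sets along both projections, with no σ-finiteness. -/
theorem quasiMeasurePreserving_snd_of_prod
    (hμ : ∀ s t, MeasurableSet s → MeasurableSet t → μ (s ×ˢ t) = μ₁ s * μ₂ t) :
    Measure.QuasiMeasurePreserving Prod.snd μ μ₂ := by
  refine ⟨measurable_snd, Measure.AbsolutelyContinuous.mk fun s hs h0 => ?_⟩
  rw [Measure.map_apply measurable_snd hs, ← Set.univ_prod, hμ _ _ .univ hs, h0, mul_zero]

/-- Uniqueness of product measures holds on σ-finite pieces, so there `μ` may be replaced by
Mathlib's product and Fubini becomes available. -/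
theorem restrict_prod_eq_of_prod
    (hμ : ∀ s t, MeasurableSet s → MeasurableSet t → μ (s ×ˢ t) = μ₁ s * μ₂ t)
    {U : Set Ω₁} {V : Set Ω₂} (hU : MeasurableSet U) (hV : MeasurableSet V)
    [SigmaFinite (μ₁.restrict U)] [SigmaFinite (μ₂.restrict V)] :
    (μ₁.restrict U).prod (μ₂.restrict V) = μ.restrict (U ×ˢ V) := by
  refine Measure.prod_eq fun s t hs ht => ?_
  rw [Measure.restrict_apply (hs.prod ht), Measure.restrict_apply hs, Measure.restrict_apply ht,
    Set.prod_inter_prod, hμ _ _ (hs.inter hU) (ht.inter hV)]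

variable {E F G : Type*} [NormedAddCommGroup E] [NormedSpace ℂ E] [CompleteSpace E]
  [NormedAddCommGroup F] [NormedSpace ℂ F] [CompleteSpace F]
  [NormedAddCommGroup G] [NormedSpace ℂ G] [CompleteSpace G]

/-- If `μ` is any product measure of `μ₁` and `μ₂`, a bounded bilinear map of two Bochner
integrable functions is Bochner integrable for `μ`, and its integral factorizes. -/
theorem integrable_and_integral_bilin_of_prod
    (hμ : ∀ s t, MeasurableSet s → MeasurableSet t → μ (s ×ˢ t) = μ₁ s * μ₂ t)
    (L : E →L[ℂ] F →L[ℂ] G) {f : Ω₁ → E} {g : Ω₂ → F}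
    (hf : Integrable f μ₁) (hg : Integrable g μ₂) :
    Integrable (fun z => L (f z.1) (g z.2)) μ ∧
      ∫ z, L (f z.1) (g z.2) ∂μ = L (∫ x, f x ∂μ₁) (∫ y, g y ∂μ₂) := by
  -- Integrable functions vanish almost everywhere off a measurable set on which the measure is
  -- σ-finite.
  obtain ⟨U, hU, hfU, hσU⟩ := hf.aefinStronglyMeasurable.exists_set_sigmaFinite
  obtain ⟨V, hV, hgV, hσV⟩ := hg.aefinStronglyMeasurable.exists_set_sigmaFinite
  have hf0 : ∀ᵐ x ∂μ₁, x ∉ U → f x = 0 := (ae_restrict_iff' hU.compl).1 hfU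
  have hg0 : ∀ᵐ y ∂μ₂, y ∉ V → g y = 0 := (ae_restrict_iff' hV.compl).1 hgV
  -- Off the rectangle one of the two arguments of `L` vanishes, up to a set that is null because
  -- its projections are.
  have h0 : ∀ᵐ z ∂μ, z ∉ U ×ˢ V → L (f z.1) (g z.2) = 0 := by
    filter_upwards [(quasiMeasurePreserving_fst_of_prod hμ).ae hf0,
      (quasiMeasurePreserving_snd_of_prod hμ).ae hg0] with z h1 h2 hz
    by_cases hz1 : z.1 ∈ U
    · rw [h2 fun hz2 => hz ⟨hz1, hz2⟩, map_zero]
    · rw [h1 hz1, map_zero, zero_apply]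
  have hr := restrict_prod_eq_of_prod hμ hU hV
  have hi : IntegrableOn (fun z => L (f z.1) (g z.2)) (U ×ˢ V) μ := by
    rw [IntegrableOn, ← hr]
    exact hf.restrict.op_fst_snd (op := fun x y => L x y) (by fun_prop)
      ⟨‖L‖, L.le_opNorm₂⟩ hg.restrict
  refine ⟨hi.integrable_of_ae_notMem_eq_zero h0, ?_⟩
  rw [← setIntegral_eq_integral_of_ae_compl_eq_zero h0, ← hr,
    integral_prod_bilin L hf.restrict hg.restrict,
    setIntegral_eq_integral_of_ae_compl_eq_zero hf0,
    setIntegral_eq_integral_of_ae_compl_eq_zero hg0]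

end ProductMeasure

/-! ### Symmetric operators on Hilbert C⋆-modules -/

section SymmetricOperators

variable {D E : Type*} [CStarAlgebra D] [PartialOrder D] [StarOrderedRing D]
  [NormedAddCommGroup E] [NormedSpace ℂ E] [Module D E] [CStarModule D E]

/-- Definiteness of the inner product at `x - y`. Through it, weak identities determine vectors and
operators. -/
theorem eq_of_forall_inner_eq {x y : E} (h : ∀ z, inner D z x = inner D z y) : x = y := by
  rw [← sub_eq_zero, ← CStarModule.inner_self (A := D) (x := x - y), CStarModule.inner_sub_right,
    h, sub_self]

/-- The norm of a C⋆-algebra is monotone on positive elements, so order bounds on inner products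
become norm bounds. -/
theorem norm_le_mul_norm_of_inner_le {x y : E} {c : ℝ} (hc : 0 ≤ c)
    (h : inner D x x ≤ (c ^ 2) • inner D y y) : ‖x‖ ≤ c * ‖y‖ := by
  refine abs_le_of_sq_le_sq' ?_ (by positivity) |>.2
  rw [mul_pow, CStarModule.norm_sq_eq D, CStarModule.norm_sq_eq D (x := y)]
  refine (CStarAlgebra.norm_le_norm_of_nonneg_of_le CStarModule.inner_self_nonneg h).trans_eq ?_
  rw [norm_smul, Real.norm_of_nonneg (by positivity)]

/-- If `W` is symmetric for a sesquilinear form `Φ` and `-c ≤ W ≤ c`, then `W ^ 2 ≤ c ^ 2`. -/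
theorem form_apply_self_le_of_symmetric {F : Type*} [AddCommGroup F] [Module ℂ F]
    (Φ : F →ₗ⋆[ℂ] F →ₗ[ℂ] D) {W : F →ₗ[ℂ] F} {c : ℝ} (hc : 0 < c)
    (hW : ∀ x y, Φ (W x) y = Φ x (W y))
    (h1 : ∀ x, -(c • Φ x x) ≤ Φ x (W x)) (h2 : ∀ x, Φ x (W x) ≤ c • Φ x x) (x : F) :
    Φ (W x) (W x) ≤ (c ^ 2) • Φ x x := by
  -- The identity behind the choice of vectors is `(c - W)(c + W)(c - W) + (c + W)(c - W)(c + W) =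
  -- 2c(c² - W²)`; both summands on the left are positive by hypothesis.
  have k1 := h1 ((c : ℂ) • x - W x)
  have k2 := h2 ((c : ℂ) • x + W x)
  rw [← sub_nonneg] at k1 k2
  have e : (Φ ((c : ℂ) • x - W x) (W ((c : ℂ) • x - W x)) -
        -(c • Φ ((c : ℂ) • x - W x) ((c : ℂ) • x - W x))) +
      (c • Φ ((c : ℂ) • x + W x) ((c : ℂ) • x + W x) -
        Φ ((c : ℂ) • x + W x) (W ((c : ℂ) • x + W x))) =
      (2 * c) • ((c ^ 2) • Φ x x - Φ (W x) (W x)) := by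
    simp only [map_sub, map_add, map_smul, map_smulₛₗ, LinearMap.sub_apply, LinearMap.add_apply,
      LinearMap.smul_apply, hW, Complex.conj_ofReal]
    simp only [Complex.coe_smul]
    module
  have k := (add_nonneg k1 k2).trans_eq e
  rw [← sub_nonneg]
  have h := smul_nonneg (inv_nonneg.2 (by positivity : (0 : ℝ) ≤ 2 * c)) k
  rwa [inv_smul_smul₀ (by positivity)] at h

/-- The form version is kept separate because it is also needed on the algebraic tensor product,
before completion, where there is only a semi-inner product. -/
theorem inner_apply_self_le_of_symmetric {W : E →L[ℂ] E} {c : ℝ} (hc : 0 < c)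
    (hW : ∀ x y, inner D (W x) y = inner D x (W y))
    (h1 : ∀ x, -(c • inner D x x) ≤ inner D x (W x))
    (h2 : ∀ x, inner D x (W x) ≤ c • inner D x x) (x : E) :
    inner D (W x) (W x) ≤ (c ^ 2) • inner D x x :=
  form_apply_self_le_of_symmetric (CStarModule.innerₛₗ (A := D) (E := E))
    (W := W.toLinearMap) hc hW h1 h2 x

theorem continuous_inner_apply_self (S : E →L[ℂ] E) :
    Continuous fun x : E => inner D x (S x) :=
  (CStarModule.continuous_inner (A := D) (E := E)).comp (continuous_id.prodMk S.continuous)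

/-- The order of a C⋆-algebra is closed, so operator bounds pass from a dense subspace to the whole
module. -/
theorem isClosed_smul_inner_self_le (S : E →L[ℂ] E) (m : ℝ) :
    IsClosed {x : E | m • inner D x x ≤ inner D x (S x)} :=
  isClosed_le ((continuous_inner_apply_self (ContinuousLinearMap.id ℂ E)).const_smul m)
    (continuous_inner_apply_self S)

theorem isClosed_inner_le_smul_inner_self (S : E →L[ℂ] E) (k : ℝ) :
    IsClosed {x : E | inner D x (S x) ≤ k • inner D x x} :=
  isClosed_le (continuous_inner_apply_self S)
    ((continuous_inner_apply_self (ContinuousLinearMap.id ℂ E)).const_smul k)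

variable [CompleteSpace E]

/-- A symmetric operator `V` with `m ≤ V ≤ k` for some `m > 0` is invertible, and its inverse is
symmetric. -/
theorem exists_symmetric_inverse {V : E →L[ℂ] E} {m k : ℝ} (hm : 0 < m)
    (hV : ∀ x y, inner D (V x) y = inner D x (V y))
    (h1 : ∀ x, m • inner D x x ≤ inner D x (V x))
    (h2 : ∀ x, inner D x (V x) ≤ k • inner D x x) :
    ∃ V' : E →L[ℂ] E, V * V' = 1 ∧ V' * V = 1 ∧ ∀ x y, inner D (V' x) y = inner D x (V' y) := by
  -- The upper bound is enlarged to some `l > m`, so that `1 - m / l` is strictly positive. Then `0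
  -- ≤ 1 - V / l ≤ 1 - m / l < 1`, and a Neumann series inverts `V / l`.
  obtain ⟨l, hml, hkl⟩ : ∃ l, m < l ∧ k ≤ l := ⟨max (m + 1) k, by simp, le_max_right _ _⟩
  have hl : 0 < l := hm.trans hml
  have h2' : ∀ x, inner D x (V x) ≤ l • inner D x x := fun x =>
    (h2 x).trans (smul_le_smul_of_nonneg_right hkl CStarModule.inner_self_nonneg)
  set W : E →L[ℂ] E := 1 - (l⁻¹ : ℝ) • V with hWdef
  have hWa : ∀ x, W x = x - (l⁻¹ : ℝ) • V x := fun x => rfl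
  have hq : 0 < 1 - l⁻¹ * m := by
    rw [sub_pos, inv_mul_lt_iff₀ hl]; linarith
  have hWn : ‖W‖ ≤ 1 - l⁻¹ * m := by
    refine ContinuousLinearMap.opNorm_le_bound _ hq.le fun x => ?_
    refine norm_le_mul_norm_of_inner_le (D := D) hq.le
      (inner_apply_self_le_of_symmetric hq ?_ ?_ ?_ x)
    · intro x y
      simp only [hWa, CStarModule.inner_sub_left, CStarModule.inner_sub_right,
        CStarModule.inner_smul_left_real, CStarModule.inner_smul_right_real, hV]
    · intro x
      have k1 : 0 ≤ inner D x (W x) := by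
        have : inner D x (W x) = l⁻¹ • (l • inner D x x - inner D x (V x)) := by
          rw [smul_sub, inv_smul_smul₀ hl.ne', hWa, CStarModule.inner_sub_right,
            CStarModule.inner_smul_right_real]
        rw [this]
        exact smul_nonneg (by positivity) (sub_nonneg.2 (h2' x))
      exact (neg_nonpos.2 (smul_nonneg hq.le CStarModule.inner_self_nonneg)).trans k1
    · intro x
      rw [hWa, CStarModule.inner_sub_right, CStarModule.inner_smul_right_real, sub_smul, one_smul,
        mul_smul]
      exact sub_le_sub_left (smul_le_smul_of_nonneg_left (h1 x) (by positivity)) _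
  have hlt : ‖W‖ < 1 := hWn.trans_lt (by have : 0 < l⁻¹ * m := by positivity
                                         linarith)
  have hu : IsUnit ((l⁻¹ : ℝ) • V) := by
    have := isUnit_one_sub_of_norm_lt_one hlt
    rwa [hWdef, sub_sub_cancel] at this
  obtain ⟨R, hR1, hR2⟩ := isUnit_iff_exists.1 hu
  have hVl : V * ((l⁻¹ : ℝ) • R) = 1 := by rw [← hR1, mul_smul_comm, smul_mul_assoc]
  have hVr : ((l⁻¹ : ℝ) • R) * V = 1 := by rw [← hR2, mul_smul_comm, smul_mul_assoc]
  refine ⟨(l⁻¹ : ℝ) • R, hVl, hVr, fun x y => ?_⟩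
  have hVl' : ∀ x, V (((l⁻¹ : ℝ) • R) x) = x := fun x => congrArg (fun T : E →L[ℂ] E => T x) hVl
  calc inner D (((l⁻¹ : ℝ) • R) x) y
      = inner D (((l⁻¹ : ℝ) • R) x) (V (((l⁻¹ : ℝ) • R) y)) := by rw [hVl']
    _ = inner D x (((l⁻¹ : ℝ) • R) y) := by rw [← hV, hVl']

end SymmetricOperators

/-! ### Invertibility and spectrum in the algebra of adjointable operators -/

section AdjointableSpectrum

variable {D E : Type*} [CStarAlgebra D] [PartialOrder D] [StarOrderedRing D]
  [NormedAddCommGroup E] [NormedSpace ℂ E] [Module D E] [CStarModule D E]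

theorem mem_adjointableOperators_of_symmetric {V : E →L[ℂ] E}
    (hV : ∀ x y, inner D (V x) y = inner D x (V y)) : V ∈ adjointableOperators D E :=
  ⟨V, fun x y => (hV y x).symm⟩

variable [CompleteSpace E]

/-- The inverse has to be adjointable as well, which is where its symmetry is used. -/
theorem isUnit_of_symmetric_of_bounds {V : adjointableOperators D E} {m k : ℝ} (hm : 0 < m)
    (hV : ∀ x y, inner D (V.1 x) y = inner D x (V.1 y))
    (h1 : ∀ x, m • inner D x x ≤ inner D x (V.1 x))
    (h2 : ∀ x, inner D x (V.1 x) ≤ k • inner D x x) : IsUnit V := by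
  obtain ⟨V', e1, e2, hV'⟩ := exists_symmetric_inverse hm hV h1 h2
  exact isUnit_iff_exists.2 ⟨⟨V', mem_adjointableOperators_of_symmetric hV'⟩,
    Subtype.ext e1, Subtype.ext e2⟩

theorem adjointableOperators_algebraMap_apply (z : ℂ) (x : E) :
    (algebraMap ℂ (adjointableOperators D E) z).1 x = z • x := by
  rw [Algebra.algebraMap_eq_smul_one]; rfl

theorem adjointableOperators_algebraMap_sub_apply (z : ℂ) (S : adjointableOperators D E) (x : E) :
    (algebraMap ℂ (adjointableOperators D E) z - S).1 x = z • x - S.1 x := by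
  rw [← adjointableOperators_algebraMap_apply (D := D)]; rfl

/-- The spectrum of a symmetric operator `S` with `m ≤ S ≤ k`, `0 < m`, lies in `[m, k]`. -/
theorem spectrum_subset_of_symmetric_of_bounds {S : adjointableOperators D E} {m k : ℝ}
    (hm : 0 < m) (hmk : m ≤ k)
    (hS : ∀ x y, inner D (S.1 x) y = inner D x (S.1 y))
    (h1 : ∀ x, m • inner D x x ≤ inner D x (S.1 x))
    (h2 : ∀ x, inner D x (S.1 x) ≤ k • inner D x x) :
    spectrum ℂ S ⊆ (fun r : ℝ => (r : ℂ)) '' Set.Icc m k := by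
  intro z hz
  by_contra hn
  refine hz ?_
  change IsUnit (algebraMap ℂ (adjointableOperators D E) z - S)
  have hr : ∀ (t : ℝ) (x : E), (t : ℂ) • x = t • x := fun t x => Complex.coe_smul t x
  by_cases him : z.im = 0
  · obtain ⟨t, rfl⟩ : ∃ t : ℝ, (t : ℂ) = z := ⟨z.re, Complex.ext rfl (by simp [him])⟩
    have ht : t < m ∨ k < t := by
      by_contra! h
      exact hn ⟨t, h, rfl⟩
    rcases ht with ht | ht
    -- Below the interval, `S - t` lies between `m - t > 0` and `k - t`.
    · rw [← IsUnit.neg_iff, neg_sub]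
      have ha : ∀ x, (S - algebraMap ℂ (adjointableOperators D E) t).1 x = S.1 x - t • x :=
        fun x => by rw [← hr, ← adjointableOperators_algebraMap_apply (D := D)]; rfl
      refine isUnit_of_symmetric_of_bounds (m := m - t) (k := k - t) (sub_pos.2 ht) ?_ ?_ ?_
      · intro x y
        simp only [ha, CStarModule.inner_sub_left, CStarModule.inner_sub_right, hS,
          CStarModule.inner_smul_left_real, CStarModule.inner_smul_right_real]
      · intro x
        rw [ha, CStarModule.inner_sub_right, CStarModule.inner_smul_right_real, sub_smul]
        exact sub_le_sub_right (h1 x) _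
      · intro x
        rw [ha, CStarModule.inner_sub_right, CStarModule.inner_smul_right_real, sub_smul]
        exact sub_le_sub_right (h2 x) _
    -- Above the interval, `t - S` lies between `t - k > 0` and `t - m`.
    · refine isUnit_of_symmetric_of_bounds (m := t - k) (k := t - m) (sub_pos.2 ht) ?_ ?_ ?_
      · intro x y
        simp only [adjointableOperators_algebraMap_sub_apply, hr, CStarModule.inner_sub_left,
          CStarModule.inner_sub_right, hS,
          CStarModule.inner_smul_left_real, CStarModule.inner_smul_right_real]
      · intro x
        rw [adjointableOperators_algebraMap_sub_apply, hr, CStarModule.inner_sub_right,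
          CStarModule.inner_smul_right_real, sub_smul]
        exact sub_le_sub_left (h2 x) _
      · intro x
        rw [adjointableOperators_algebraMap_sub_apply, hr, CStarModule.inner_sub_right,
          CStarModule.inner_smul_right_real, sub_smul]
        exact sub_le_sub_left (h1 x) _
  -- For non-real `z`, with `W = S - Re z`, the product `(z - S)(z̄ - S) = W² + (Im z)²` is
  -- symmetric and bounded below by `(Im z)² > 0`.
  · set W : E →L[ℂ] E := S.1 - (z.re : ℝ) • 1 with hWdef
    have hWa : ∀ x, W x = S.1 x - z.re • x := fun x => rfl
    have hW : ∀ x y, inner D (W x) y = inner D x (W y) := fun x y => by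
      simp only [hWa, CStarModule.inner_sub_left, CStarModule.inner_sub_right, hS,
          CStarModule.inner_smul_left_real, CStarModule.inner_smul_right_real]
    -- A crude constant with `-c ≤ W ≤ c`. It serves only to bound `W²` above, as the invertibility
    -- criterion asks for an upper bound too.
    have hc : 0 < k + |z.re| := 
      add_pos_of_pos_of_nonneg (hm.trans_le hmk) (abs_nonneg _)
    have hW2 := inner_apply_self_le_of_symmetric (D := D) hc hW
      (fun x => by
        rw [hWa, CStarModule.inner_sub_right, CStarModule.inner_smul_right_real, ← neg_smul,
          le_sub_iff_add_le, ← add_smul]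
        refine le_trans ?_ (h1 x)
        refine smul_le_smul_of_nonneg_right ?_ CStarModule.inner_self_nonneg
        linarith [le_abs_self z.re])
      (fun x => by
        rw [hWa, CStarModule.inner_sub_right, CStarModule.inner_smul_right_real,
          sub_le_iff_le_add, ← add_smul]
        refine (h2 x).trans ?_
        refine smul_le_smul_of_nonneg_right ?_ CStarModule.inner_self_nonneg
        linarith [neg_abs_le z.re])
    -- Stated for a general `w` so as to cover both `z` and its conjugate.
    have hzW : ∀ (w : ℂ) (x : E), w.re = z.re →
        (algebraMap ℂ (adjointableOperators D E) w - S).1 x =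
          ((w.im : ℂ) * Complex.I) • x - W x := by
      intro w x hw
      rw [adjointableOperators_algebraMap_sub_apply, hWa, ← hr]
      nth_rw 1 [← Complex.re_add_im w]
      rw [hw]
      module
    set P := algebraMap ℂ (adjointableOperators D E) z - S with hP
    set Q := algebraMap ℂ (adjointableOperators D E) (star z) - S with hQ
    -- Commutation lets invertibility pass from the product to the factor `P = z - S`.
    have hcomm : Commute P Q :=
      (Algebra.commute_algebraMap_right _ P).sub_right
        ((Algebra.commute_algebraMap_left _ S).sub_left (Commute.refl S))
    have hPQ : ∀ x, (P * Q).1 x = W (W x) + (z.im ^ 2) • x := by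
      intro x
      change P.1 (Q.1 x) = _
      rw [hP, hzW z _ rfl, hQ, hzW (star z) x (by simp)]
      simp only [map_sub, map_smul, Complex.star_def, Complex.conj_im, ← hr]
      push_cast
      have hI : (Complex.I) ^ 2 = -1 := Complex.I_sq
      have : ((z.im : ℂ) * Complex.I) • ((-(z.im : ℂ) * Complex.I) • x) = ((z.im : ℂ) ^ 2) • x := by
        rw [smul_smul]; congr 1; linear_combination -(z.im : ℂ) ^ 2 * hI
      rw [smul_sub, this]
      module
    have hu : IsUnit (P * Q) := by
      refine isUnit_of_symmetric_of_bounds (m := z.im ^ 2)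
        (k := (k + |z.re|) ^ 2 + z.im ^ 2) (by positivity) ?_ ?_ ?_
      · intro x y
        simp only [hPQ, CStarModule.inner_add_left, CStarModule.inner_add_right, hW,
          CStarModule.inner_smul_left_real, CStarModule.inner_smul_right_real]
      · intro x
        rw [hPQ, CStarModule.inner_add_right, CStarModule.inner_smul_right_real, ← hW]
        exact le_add_of_nonneg_left CStarModule.inner_self_nonneg
      · intro x
        rw [hPQ, CStarModule.inner_add_right, CStarModule.inner_smul_right_real, ← hW, add_smul]
        exact add_le_add_left (hW2 x) _
    exact (hcomm.isUnit_mul_iff.1 hu).1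

end AdjointableSpectrum

/-! ### Biframe operators are linear and symmetric -/

section BiframeOperator

variable {A E : Type*} [CStarAlgebra A] [PartialOrder A] [StarOrderedRing A]
  [NormedAddCommGroup E] [NormedSpace ℂ E] [Module A E] [CStarModule A E]

/-- Polarization: the diagonal identity is expanded at `x + y` and at `x + i y`. Neither boundedness
nor an adjoint of `T` is presupposed. -/
theorem symmetric_of_forall_isSelfAdjoint {T : E →ₗ[ℂ] E}
    (h : ∀ x, inner A (T x) x = inner A x (T x)) (x y : E) :
    inner A (T x) y = inner A x (T y) := by
  have h1 := h (x + y)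
  have h2 := h (x + Complex.I • y)
  simp only [map_add, map_smul, CStarModule.inner_add_left, CStarModule.inner_add_right,
    CStarModule.inner_smul_left_complex, CStarModule.inner_smul_right_complex, h,
    Complex.star_def, Complex.conj_I] at h1 h2
  have e1 : inner A (T x) y - inner A x (T y) = inner A y (T x) - inner A (T y) x := by
    rw [sub_eq_sub_iff_add_eq_add]
    have h1' := h1
    rw [← sub_eq_zero] at h1' ⊢
    rw [← h1']
    abel
  have e2 : Complex.I • (inner A (T x) y - inner A x (T y)) =
      Complex.I • (inner A (T y) x - inner A y (T x)) := by
    rw [← sub_eq_zero] at h2 ⊢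
    rw [← h2]
    module
  have e3 := smul_right_injective A Complex.I_ne_zero e2
  rw [← sub_eq_zero]
  -- By `e1` and `e3` the difference equals both an element and its negative.
  have e4 : (2 : ℂ) • (inner A (T x) y - inner A x (T y)) = 0 := by
    rw [two_smul]
    nth_rw 1 [e1]
    rw [e3]
    abel
  exact (smul_eq_zero.1 e4).resolve_left two_ne_zero

variable {Ω : Type*} [MeasurableSpace Ω] {μ : Measure Ω} {X Y : Ω → E} {S : E → E}

/-- A biframe operator on the whole module is linear. -/
theorem exists_linearMap_eq_of_isBiframeOperatorOn
    (hS : IsBiframeOperatorOn A Set.univ μ X Y S) : ∃ T : E →ₗ[ℂ] E, ∀ x, T x = S x := by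
  have hi := fun f g => (hS f trivial g trivial).1
  have he := fun f g => (hS f trivial g trivial).2
  refine ⟨⟨⟨S, fun f g => ?_⟩, fun c f => ?_⟩, fun _ => rfl⟩
  -- The weak integral is linear in `f`, and testing against every `z` recovers the value of `S`.
  · refine eq_of_forall_inner_eq (D := A) fun z => ?_
    rw [CStarModule.inner_add_right, he, he, he, ← integral_add (hi f z) (hi g z)]
    simp only [CStarModule.inner_add_right, add_mul]
  · refine eq_of_forall_inner_eq (D := A) fun z => ?_
    rw [RingHom.id_apply, CStarModule.inner_smul_right_complex, he, he, ← integral_smul]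
    simp only [CStarModule.inner_smul_right_complex, smul_mul_assoc]

/-- A biframe operator of a biframe is a symmetric linear map between the frame bounds. -/
theorem exists_symmetric_linearMap_of_isContinuousBiframeOn {a b : ℝ}
    (h : IsContinuousBiframeOn A Set.univ μ X Y a b)
    (hS : IsBiframeOperatorOn A Set.univ μ X Y S) :
    ∃ T : E →ₗ[ℂ] E, (∀ x, T x = S x) ∧ (∀ x y, inner A (T x) y = inner A x (T y)) ∧
      (∀ x, a • inner A x x ≤ inner A x (T x)) ∧ ∀ x, inner A x (T x) ≤ b • inner A x x := by
  obtain ⟨T, hT⟩ := exists_linearMap_eq_of_isBiframeOperatorOn hS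
  have he : ∀ x, inner A x (T x) = ∫ ω, ⟪x, X ω⟫ₗ[A] * ⟪Y ω, x⟫ₗ[A] ∂μ := fun x => by
    rw [hT]; exact (hS x trivial x trivial).2
  have hl : ∀ x, a • inner A x x ≤ inner A x (T x) := fun x => by
    rw [he]; exact h.lower_bound x trivial
  refine ⟨T, hT, symmetric_of_forall_isSelfAdjoint fun x => ?_, hl, fun x => ?_⟩
  -- Since `X` and `Y` may differ, symmetry is not visible in the integrand; it comes from the lower
  -- bound, which makes the quadratic form positive and hence self-adjoint.
  · have h0 : 0 ≤ inner A x (T x) :=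
      (smul_nonneg h.pos.le CStarModule.inner_self_nonneg).trans (hl x)
    rw [← CStarModule.star_inner, (IsSelfAdjoint.of_nonneg h0).star_eq]
  · rw [he]; exact h.upper_bound x trivial

end BiframeOperator

/-! ### Tensor products of symmetric operators -/

section TensorOperator

variable {A B M N : Type*} [CStarAlgebra A] [PartialOrder A] [StarOrderedRing A]
  [CStarAlgebra B] [PartialOrder B] [StarOrderedRing B]
  [NormedAddCommGroup M] [NormedSpace ℂ M] [Module A M] [IsScalarTower ℂ A M] [CStarModule A M]
  [NormedAddCommGroup N] [NormedSpace ℂ N] [Module B N] [IsScalarTower ℂ B N] [CStarModule B N]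

/-- Moving `T` to the other slot leaves only the linearity of the inner product. This is needed to
take algebra coefficients out of `T (∑ aᵢ xᵢ)`. -/
theorem map_smul_of_symmetric {T : M →ₗ[ℂ] M}
    (h : ∀ x y, inner A (T x) y = inner A x (T y)) (a : A) (x : M) : T (a • x) = a • T x :=
  eq_of_forall_inner_eq (D := A) fun z => by
    rw [← h, CStarModule.inner_op_smul_right, CStarModule.inner_op_smul_right, h]

/-- The matrix `⟨T xᵢ, xⱼ⟩` of a positive operator `T` is positive. -/
theorem exists_factor_of_positive {n : Type*} [Fintype n] [DecidableEq n] {T : M →ₗ[ℂ] M}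
    (hT : ∀ x y, inner A (T x) y = inner A x (T y)) (h0 : ∀ x, 0 ≤ inner A x (T x)) (x : n → M) :
    ∃ R : n → n → A, ∀ i j, inner A (x j) (T (x i)) = ∑ k, star (R k i) * R k j := by
  let G : CStarMatrix n n A := CStarMatrix.ofMatrix (fun i j => inner A (x j) (T (x i)))
  have hGa : ∀ i j, G i j = inner A (x j) (T (x i)) := fun _ _ => rfl
  obtain ⟨R, hR⟩ := exists_matrix_factor G
    (by ext i j; rw [CStarMatrix.star_apply, hGa, hGa, CStarModule.star_inner, hT])
    (fun a => by
      -- The quadratic form of the matrix at `a` is that of `T` at `∑ aᵢ xᵢ`.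
      have := h0 (∑ i, a i • x i)
      simp only [map_sum, map_smul_of_symmetric hT,
        CStarModule.inner_sum_left, CStarModule.inner_sum_right,
        CStarModule.inner_op_smul_left, CStarModule.inner_op_smul_right] at this
      simpa only [hGa, Finset.mul_sum, mul_assoc] using this)
  refine ⟨fun k i => R k i, fun i j => ?_⟩
  have := congrArg (fun P : CStarMatrix n n A => P i j) hR
  rw [← hGa]
  simpa [CStarMatrix.mul_apply, CStarMatrix.star_apply] using this

/-- A tensor version of Schur's product theorem: if the two matrices factor through `R` and `Q`,
their entrywise tensor product sums to the squares of `∑ᵢ R k i ⊗ Q l i` over all `(k, l)`. The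
identity is purely algebraic, and so it survives the map into the spatial tensor product. -/
theorem algInner_map_self {T : M →ₗ[ℂ] M} {P : N →ₗ[ℂ] N}
    (hT : ∀ x y, inner A (T x) y = inner A x (T y)) (hT0 : ∀ x, 0 ≤ inner A x (T x))
    (hP : ∀ x y, inner B (P x) y = inner B x (P y)) (hP0 : ∀ x, 0 ≤ inner B x (P x))
    (z : M ⊗[ℂ] N) : ∃ (n : ℕ) (u : Fin n × Fin n → A ⊗[ℂ] B),
    algInner A B M N z (TensorProduct.map T P z) = ∑ p, star (u p) * u p := by
  obtain ⟨n, x, y, rfl⟩ := TensorProduct.exists_sum_tmul_eq z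
  obtain ⟨R, hR⟩ := exists_factor_of_positive hT hT0 x
  obtain ⟨Q, hQ⟩ := exists_factor_of_positive hP hP0 y
  refine ⟨n, fun p => ∑ i, R p.1 i ⊗ₜ Q p.2 i, ?_⟩
  have hL : algInner A B M N (∑ i, x i ⊗ₜ y i) (TensorProduct.map T P (∑ i, x i ⊗ₜ y i)) =
      ∑ i, ∑ j, ∑ k, ∑ l, (star (R k j) * R k i) ⊗ₜ[ℂ] (star (Q l j) * Q l i) := by
    rw [map_sum, Finset.sum_comm]
    simp only [map_sum, LinearMap.sum_apply, TensorProduct.map_tmul, algInner_tmul, hR, hQ,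
      TensorProduct.sum_tmul, TensorProduct.tmul_sum]
    exact Finset.sum_congr rfl fun i _ => Finset.sum_congr rfl fun j _ => Finset.sum_comm
  have hS : ∀ k l, star (∑ i, R k i ⊗ₜ[ℂ] Q l i) * (∑ i, R k i ⊗ₜ[ℂ] Q l i) =
      ∑ i, ∑ j, (star (R k j) * R k i) ⊗ₜ[ℂ] (star (Q l j) * Q l i) := by
    intro k l
    rw [star_sum, Finset.sum_mul_sum, Finset.sum_comm]
    simp only [TensorProduct.star_tmul, Algebra.TensorProduct.tmul_mul_tmul]
  rw [hL, Fintype.sum_prod_type]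
  simp only [hS]
  calc _ = ∑ i, ∑ k, ∑ l, ∑ j, (star (R k j) * R k i) ⊗ₜ[ℂ] (star (Q l j) * Q l i) := by
        refine Finset.sum_congr rfl fun i _ => ?_
        rw [Finset.sum_comm]
        exact Finset.sum_congr rfl fun k _ => Finset.sum_comm
    _ = _ := by
        rw [Finset.sum_comm]
        exact Finset.sum_congr rfl fun k _ => Finset.sum_comm

theorem algInner_map_left {T : M →ₗ[ℂ] M} {P : N →ₗ[ℂ] N}
    (hT : ∀ x y, inner A (T x) y = inner A x (T y))
    (hP : ∀ x y, inner B (P x) y = inner B x (P y)) (z w : M ⊗[ℂ] N) :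
    algInner A B M N (TensorProduct.map T P z) w =
      algInner A B M N z (TensorProduct.map T P w) := by
  induction z using TensorProduct.induction_on with
  | zero => simp
  | add z z' h h' => simp [h, h']
  | tmul x y =>
    induction w using TensorProduct.induction_on with
    | zero => simp
    | add z z' h h' => simp only [map_add, h, h']
    | tmul x' y' => simp [algInner_tmul, hT, hP]

variable {H K : Type*}
  [NormedAddCommGroup H] [InnerProductSpace ℂ H] [CompleteSpace H]
  [NormedAddCommGroup K] [InnerProductSpace ℂ K] [CompleteSpace K]
  (π : A →⋆ₐ[ℂ] (H →L[ℂ] H)) (ρ : B →⋆ₐ[ℂ] (K →L[ℂ] K))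

/-- The operator `T ⊗ P` on the algebraic tensor product. -/
def preMap (T : M →ₗ[ℂ] M) (P : N →ₗ[ℂ] N) : PreExt M N π ρ →ₗ[ℂ] PreExt M N π ρ :=
  TensorProduct.map T P

variable {π ρ}

theorem preInner_preMap_left {T : M →ₗ[ℂ] M} {P : N →ₗ[ℂ] N}
    (hT : ∀ x y, inner A (T x) y = inner A x (T y))
    (hP : ∀ x y, inner B (P x) y = inner B x (P y)) (z w : PreExt M N π ρ) :
    preInner π ρ M N (preMap π ρ T P z) w = preInner π ρ M N z (preMap π ρ T P w) :=
  congrArg (spatialMk π ρ) (algInner_map_left hT hP z w)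

theorem preInner_preMap_nonneg {T : M →ₗ[ℂ] M} {P : N →ₗ[ℂ] N}
    (hT : ∀ x y, inner A (T x) y = inner A x (T y)) (hT0 : ∀ x, 0 ≤ inner A x (T x))
    (hP : ∀ x y, inner B (P x) y = inner B x (P y)) (hP0 : ∀ x, 0 ≤ inner B x (P x))
    (z : PreExt M N π ρ) : 0 ≤ preInner π ρ M N z (preMap π ρ T P z) := by
  obtain ⟨n, u, hu⟩ := algInner_map_self hT hT0 hP hP0 z
  rw [preInner_apply]
  refine le_of_le_of_eq ?_ (congrArg (spatialMk π ρ) hu).symm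
  rw [map_sum]
  refine Finset.sum_nonneg fun p _ => ?_
  rw [map_mul, map_star]
  exact star_mul_self_nonneg _

theorem preMap_sub_left (T T' : M →ₗ[ℂ] M) (P : N →ₗ[ℂ] N) (z : PreExt M N π ρ) :
    preMap π ρ (T - T') P z = preMap π ρ T P z - preMap π ρ T' P z := by
  refine congrArg (fun f : M ⊗[ℂ] N →ₗ[ℂ] M ⊗[ℂ] N => f z) (?_ : TensorProduct.map _ _ =
    TensorProduct.map T P - TensorProduct.map T' P)
  ext x y
  simp [TensorProduct.sub_tmul]

theorem preMap_sub_right (T : M →ₗ[ℂ] M) (P P' : N →ₗ[ℂ] N) (z : PreExt M N π ρ) :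
    preMap π ρ T (P - P') z = preMap π ρ T P z - preMap π ρ T P' z := by
  refine congrArg (fun f : M ⊗[ℂ] N →ₗ[ℂ] M ⊗[ℂ] N => f z) (?_ : TensorProduct.map _ _ =
    TensorProduct.map T P - TensorProduct.map T P')
  ext x y
  simp [TensorProduct.tmul_sub]

theorem preMap_smul_one_smul_one (a c : ℂ) (z : PreExt M N π ρ) :
    preMap π ρ (a • (1 : M →ₗ[ℂ] M)) (c • (1 : N →ₗ[ℂ] N)) z = (a * c) • z := by
  refine congrArg (fun f : M ⊗[ℂ] N →ₗ[ℂ] M ⊗[ℂ] N => f z) (?_ : TensorProduct.map _ _ =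
    (a * c) • (1 : M ⊗[ℂ] N →ₗ[ℂ] M ⊗[ℂ] N))
  rw [TensorProduct.map_smul_left, TensorProduct.map_smul_right, TensorProduct.map_one, smul_smul]

/-- Both factors of `(T - T') ⊗ P` are positive. -/
theorem preInner_preMap_mono_left {T T' : M →ₗ[ℂ] M} {P : N →ₗ[ℂ] N}
    (hT : ∀ x y, inner A (T x) y = inner A x (T y))
    (hT' : ∀ x y, inner A (T' x) y = inner A x (T' y))
    (h : ∀ x, inner A x (T' x) ≤ inner A x (T x))
    (hP : ∀ x y, inner B (P x) y = inner B x (P y)) (hP0 : ∀ x, 0 ≤ inner B x (P x))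
    (z : PreExt M N π ρ) :
    preInner π ρ M N z (preMap π ρ T' P z) ≤ preInner π ρ M N z (preMap π ρ T P z) := by
  have := preInner_preMap_nonneg (π := π) (ρ := ρ) (T := T - T') (P := P)
    (fun x y => by simp [hT, hT']) (fun x => by simpa using h x) hP hP0 z
  rwa [preMap_sub_left, map_sub, sub_nonneg] at this

theorem preInner_preMap_mono_right {T : M →ₗ[ℂ] M} {P P' : N →ₗ[ℂ] N}
    (hT : ∀ x y, inner A (T x) y = inner A x (T y)) (hT0 : ∀ x, 0 ≤ inner A x (T x))
    (hP : ∀ x y, inner B (P x) y = inner B x (P y))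
    (hP' : ∀ x y, inner B (P' x) y = inner B x (P' y))
    (h : ∀ x, inner B x (P' x) ≤ inner B x (P x)) (z : PreExt M N π ρ) :
    preInner π ρ M N z (preMap π ρ T P' z) ≤ preInner π ρ M N z (preMap π ρ T P z) := by
  have := preInner_preMap_nonneg (π := π) (ρ := ρ) (T := T) (P := P - P') hT hT0
    (fun x y => by simp [hP, hP']) (fun x => by simpa using h x) z
  rwa [preMap_sub_right, map_sub, sub_nonneg] at this

section ScalarBounds

variable {T : M →ₗ[ℂ] M} {P : N →ₗ[ℂ] N} {a b c d : ℝ}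

theorem symmetric_smul_one (t : ℝ) (x y : M) :
    inner A (((t : ℂ) • (1 : M →ₗ[ℂ] M)) x) y = inner A x (((t : ℂ) • (1 : M →ₗ[ℂ] M)) y) := by
  simp

theorem inner_smul_one (t : ℝ) (x : M) :
    inner A x (((t : ℂ) • (1 : M →ₗ[ℂ] M)) x) = t • inner A x x := by
  simp

/-- `a c ≤ T ⊗ P` if `a ≤ T` and `c ≤ P`. -/
theorem smul_preInner_le_preMap (ha : 0 ≤ a) (hc : 0 ≤ c)
    (hT : ∀ x y, inner A (T x) y = inner A x (T y))
    (hTa : ∀ x, a • inner A x x ≤ inner A x (T x))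
    (hP : ∀ x y, inner B (P x) y = inner B x (P y))
    (hPc : ∀ x, c • inner B x x ≤ inner B x (P x)) (z : PreExt M N π ρ) :
    (a * c) • preInner π ρ M N z z ≤ preInner π ρ M N z (preMap π ρ T P z) := by
  have h0 : (a * c) • preInner π ρ M N z z = preInner π ρ M N z
      (preMap π ρ ((a : ℂ) • (1 : M →ₗ[ℂ] M)) ((c : ℂ) • (1 : N →ₗ[ℂ] N)) z) := by
    rw [preMap_smul_one_smul_one, ← Complex.ofReal_mul, map_smul, Complex.coe_smul]
  rw [h0]
  -- One factor at a time: `a ⊗ c ≤ a ⊗ P ≤ T ⊗ P`, using `a ≥ 0` and `P ≥ 0`.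
  refine (preInner_preMap_mono_right (symmetric_smul_one a) (fun x => ?_) hP
    (symmetric_smul_one c) (fun x => ?_) z).trans
    (preInner_preMap_mono_left hT (symmetric_smul_one a) (fun x => ?_) hP (fun x => ?_) z)
  · rw [inner_smul_one]
    exact smul_nonneg ha CStarModule.inner_self_nonneg
  · rw [inner_smul_one]
    exact hPc x
  · rw [inner_smul_one]
    exact hTa x
  · exact (smul_nonneg hc CStarModule.inner_self_nonneg).trans (hPc x)

/-- `T ⊗ P ≤ b d` if `0 ≤ T ≤ b` and `P ≤ d`. -/
theorem preMap_le_smul_preInner (hd : 0 ≤ d)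
    (hT : ∀ x y, inner A (T x) y = inner A x (T y)) (hT0 : ∀ x, 0 ≤ inner A x (T x))
    (hTb : ∀ x, inner A x (T x) ≤ b • inner A x x)
    (hP : ∀ x y, inner B (P x) y = inner B x (P y))
    (hPd : ∀ x, inner B x (P x) ≤ d • inner B x x) (z : PreExt M N π ρ) :
    preInner π ρ M N z (preMap π ρ T P z) ≤ (b * d) • preInner π ρ M N z z := by
  have h0 : (b * d) • preInner π ρ M N z z = preInner π ρ M N z
      (preMap π ρ ((b : ℂ) • (1 : M →ₗ[ℂ] M)) ((d : ℂ) • (1 : N →ₗ[ℂ] N)) z) := by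
    rw [preMap_smul_one_smul_one, ← Complex.ofReal_mul, map_smul, Complex.coe_smul]
  rw [h0]
  -- Here `T ⊗ P ≤ T ⊗ d ≤ b ⊗ d`, using `T ≥ 0` and `d ≥ 0`.
  refine (preInner_preMap_mono_right hT hT0 (symmetric_smul_one d) hP (fun x => ?_) z).trans
    (preInner_preMap_mono_left (symmetric_smul_one b) hT (fun x => ?_) (symmetric_smul_one d)
      (fun x => ?_) z)
  · rw [inner_smul_one]
    exact hPd x
  · rw [inner_smul_one]
    exact hTb x
  · rw [inner_smul_one]
    exact smul_nonneg hd CStarModule.inner_self_nonneg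

end ScalarBounds

/-- A symmetric operator `U` on the algebraic tensor product with `m ≤ U ≤ k`, `0 ≤ m`, extends to
a symmetric operator on the exterior tensor product with the same bounds. -/
theorem exists_extension_of_symmetric {U : PreExt M N π ρ →ₗ[ℂ] PreExt M N π ρ} {m k : ℝ}
    (hm : 0 ≤ m) (hk : 0 < k)
    (hU : ∀ z w, preInner π ρ M N (U z) w = preInner π ρ M N z (U w))
    (h1 : ∀ z, m • preInner π ρ M N z z ≤ preInner π ρ M N z (U z))
    (h2 : ∀ z, preInner π ρ M N z (U z) ≤ k • preInner π ρ M N z z) :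
    ∃ S : ExtTensorProduct π ρ M N →L[ℂ] ExtTensorProduct π ρ M N,
      (∀ z, S (extMk π ρ M N z) = extMk π ρ M N (U z)) ∧
      (∀ x y, inner (SpatialTensor π ρ) (S x) y = inner (SpatialTensor π ρ) x (S y)) ∧
      (∀ x, m • inner (SpatialTensor π ρ) x x ≤ inner (SpatialTensor π ρ) x (S x)) ∧
      ∀ x, inner (SpatialTensor π ρ) x (S x) ≤ k • inner (SpatialTensor π ρ) x x := by
  -- Boundedness is not assumed; it follows from `U² ≤ k²`, where `-k ≤ U` is free because `U ≥ m ≥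
  -- 0`.
  have hb : ∀ z, ‖U z‖ ≤ k * ‖z‖ := fun z => by
    refine abs_le_of_sq_le_sq' ?_ (by positivity) |>.2
    rw [mul_pow, pre_norm_sq, pre_norm_sq]
    have h := form_apply_self_le_of_symmetric (preInner π ρ M N) hk hU (fun x => by
      refine le_trans ?_ (h1 x)
      rw [← neg_smul]
      exact smul_le_smul_of_nonneg_right (by linarith) (preInner_self_nonneg x)) h2 z
    refine (CStarAlgebra.norm_le_norm_of_nonneg_of_le (preInner_self_nonneg _) h).trans_eq ?_
    rw [norm_smul, Real.norm_of_nonneg (by positivity)]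
  set S : ExtTensorProduct π ρ M N →L[ℂ] ExtTensorProduct π ρ M N :=
    ((extMk π ρ M N).toLinearMap ∘ₗ U).extendOfNorm (extMk π ρ M N).toLinearMap
  have hS : ∀ z, S (extMk π ρ M N z) = extMk π ρ M N (U z) := fun z =>
    LinearMap.extendOfNorm_eq denseRange_extMk
      ⟨k, fun z => (norm_extMk (U z)).trans_le
        ((hb z).trans_eq (congrArg (k * ·) (norm_extMk z).symm))⟩ z
  refine ⟨S, hS, fun x y => ?_, fun x => ?_, fun x => ?_⟩
  · change extInner π ρ M N (S x) y = extInner π ρ M N x (S y)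
    refine ext_induction (p := fun x => extInner π ρ M N (S x) y = extInner π ρ M N x (S y))
      (isClosed_eq (by fun_prop) (by fun_prop)) (fun z => ?_) x
    refine ext_induction (p := fun y => extInner π ρ M N (S (extMk π ρ M N z)) y =
      extInner π ρ M N (extMk π ρ M N z) (S y))
      (isClosed_eq (by fun_prop) (by fun_prop)) (fun w => ?_) y
    rw [hS, hS, extInner_mk, extInner_mk, hU]
  · have h : ∀ z, m • extInner π ρ M N (extMk π ρ M N z) (extMk π ρ M N z) ≤
        extInner π ρ M N (extMk π ρ M N z) (S (extMk π ρ M N z)) := fun z => by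
      rw [hS, extInner_mk, extInner_mk]
      exact h1 z
    exact ext_induction (p := fun x => m • inner (SpatialTensor π ρ) x x ≤
      inner (SpatialTensor π ρ) x (S x)) (isClosed_smul_inner_self_le S m) h x
  · have h : ∀ z, extInner π ρ M N (extMk π ρ M N z) (S (extMk π ρ M N z)) ≤
        k • extInner π ρ M N (extMk π ρ M N z) (extMk π ρ M N z) := fun z => by
      rw [hS, extInner_mk, extInner_mk]
      exact h2 z
    exact ext_induction (p := fun x => inner (SpatialTensor π ρ) x (S x) ≤
      k • inner (SpatialTensor π ρ) x x) (isClosed_inner_le_smul_inner_self S k) h x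

end TensorOperator

/-! ### Elementary tensors as bounded bilinear maps; density -/

section ElementaryTensors

variable {A B M N H K : Type*} [CStarAlgebra A] [PartialOrder A] [StarOrderedRing A]
  [CStarAlgebra B] [PartialOrder B] [StarOrderedRing B]
  [NormedAddCommGroup H] [InnerProductSpace ℂ H] [CompleteSpace H]
  [NormedAddCommGroup K] [InnerProductSpace ℂ K] [CompleteSpace K]

theorem norm_opTensor_le (S : H →L[ℂ] H) (T : K →L[ℂ] K) : ‖opTensor S T‖ ≤ ‖S‖ * ‖T‖ := by
  refine ContinuousLinearMap.opNorm_le_bound _ (by positivity) fun z => ?_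
  refine UniformSpace.Completion.induction_on (α := H ⊗[ℂ] K)
    (p := fun z : HilbertTensor H K => ‖opTensor S T z‖ ≤ ‖S‖ * ‖T‖ * ‖z‖) z
    (isClosed_le (opTensor S T).continuous.norm (continuous_const.mul continuous_norm))
    fun w => ?_
  have h1 : opTensor S T (w : UniformSpace.Completion (H ⊗[ℂ] K)) =
      (TensorProduct.mapL S T w : UniformSpace.Completion (H ⊗[ℂ] K)) :=
    (TensorProduct.mapL S T).completion_apply_coe w
  rw [h1]
  refine (UniformSpace.Completion.norm_coe (E := H ⊗[ℂ] K) _).trans_le ?_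
  refine ((TensorProduct.mapL S T).le_of_opNorm_le (TensorProduct.norm_mapL_le S T) w).trans_eq ?_
  exact congrArg (‖S‖ * ‖T‖ * ·) (UniformSpace.Completion.norm_coe w).symm

variable (π : A →⋆ₐ[ℂ] (H →L[ℂ] H)) (ρ : B →⋆ₐ[ℂ] (K →L[ℂ] K))

/-- Representations are contractive. This half of the cross-norm property is all that integrating
the bilinear map requires. -/
theorem norm_stmul_le (a : A) (b : B) : ‖stmul π ρ a b‖ ≤ ‖a‖ * ‖b‖ := by
  refine (norm_spatialMk π ρ _).trans_le ?_
  rw [spatialRep_tmul]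
  refine (norm_opTensor_le _ _).trans ?_
  gcongr
  · exact NonUnitalStarAlgHom.norm_apply_le π a
  · exact NonUnitalStarAlgHom.norm_apply_le ρ b

/-- The elementary tensor `a ⊗ b` as a bounded bilinear map. -/
noncomputable def stmulL : A →L[ℂ] B →L[ℂ] SpatialTensor π ρ :=
  LinearMap.mkContinuous₂
    ((TensorProduct.mk ℂ A B).compr₂ (spatialMk π ρ).toAlgHom.toLinearMap) 1
    fun a b => by rw [one_mul]; exact norm_stmul_le π ρ a b

theorem stmulL_apply (a : A) (b : B) : stmulL π ρ a b = stmul π ρ a b := rfl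

theorem stmul_mul_stmul (a a' : A) (b b' : B) :
    stmul π ρ a b * stmul π ρ a' b' = stmul π ρ (a * a') (b * b') := by
  rw [stmul, stmul, ← map_mul, Algebra.TensorProduct.tmul_mul_tmul, stmul]

/-- If `a = u⋆u` and `b = v⋆v`, then `a ⊗ b = (u ⊗ v)⋆(u ⊗ v)`. -/
theorem stmul_nonneg {a : A} {b : B} (ha : 0 ≤ a) (hb : 0 ≤ b) : 0 ≤ stmul π ρ a b := by
  obtain ⟨u, rfl⟩ := CStarAlgebra.nonneg_iff_eq_star_mul_self.1 ha
  obtain ⟨v, rfl⟩ := CStarAlgebra.nonneg_iff_eq_star_mul_self.1 hb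
  have h : stmul π ρ (star u * u) (star v * v) = star (stmul π ρ u v) * stmul π ρ u v := by
    rw [stmul, stmul, ← map_star, ← map_mul, TensorProduct.star_tmul,
      Algebra.TensorProduct.tmul_mul_tmul]
  rw [h]
  exact star_mul_self_nonneg _

variable [NormedAddCommGroup M] [NormedSpace ℂ M] [Module A M] [IsScalarTower ℂ A M]
  [CStarModule A M]
  [NormedAddCommGroup N] [NormedSpace ℂ N] [Module B N] [IsScalarTower ℂ B N] [CStarModule B N]

theorem norm_etmul_le (x : M) (y : N) : ‖etmul π ρ x y‖ ≤ ‖x‖ * ‖y‖ := by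
  refine abs_le_of_sq_le_sq' ?_ (by positivity) |>.2
  rw [mul_pow, CStarModule.norm_sq_eq (SpatialTensor π ρ), inner_etmul,
    CStarModule.norm_sq_eq A (x := x), CStarModule.norm_sq_eq B (x := y)]
  exact norm_stmul_le π ρ _ _

/-- The elementary tensor `x ⊗ y` as a bounded bilinear map. -/
noncomputable def etmulL : M →L[ℂ] N →L[ℂ] ExtTensorProduct π ρ M N :=
  LinearMap.mkContinuous₂
    ((TensorProduct.mk ℂ M N).compr₂
      ((extMk π ρ M N).toLinearMap : M ⊗[ℂ] N →ₗ[ℂ] ExtTensorProduct π ρ M N)) 1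
    fun a b => by rw [one_mul]; exact norm_etmul_le π ρ a b

theorem etmulL_apply (x : M) (y : N) : etmulL π ρ x y = etmul π ρ x y := rfl

variable {π ρ}

/-- A closed additive property of elementary tensors holds on the exterior tensor product. -/
theorem ext_induction_etmul {p : ExtTensorProduct π ρ M N → Prop} (hc : IsClosed {x | p x})
    (h0 : p 0) (ht : ∀ x y, p (etmul π ρ x y)) (ha : ∀ u v, p u → p v → p (u + v))
    (x : ExtTensorProduct π ρ M N) : p x := by
  refine ext_induction hc (fun z => ?_) x
  change M ⊗[ℂ] N at z
  induction z using TensorProduct.induction_on with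
  | zero => exact (congrArg p (map_zero (extMk π ρ M N))).mpr h0
  | tmul x y => exact ht x y
  | add a b hA hB => exact (congrArg p (map_add (extMk π ρ M N) a b)).mpr (ha _ _ hA hB)

/-- Bounded operators on the exterior tensor product that agree weakly on elementary tensors are
equal. -/
theorem eq_of_inner_etmul_eq {S S' : ExtTensorProduct π ρ M N →L[ℂ] ExtTensorProduct π ρ M N}
    (h : ∀ (f f' : M) (g g' : N),
      inner (SpatialTensor π ρ) (etmul π ρ f' g') (S (etmul π ρ f g)) =
        inner (SpatialTensor π ρ) (etmul π ρ f' g') (S' (etmul π ρ f g))) : S = S' := by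
  ext x
  refine ext_induction_etmul (p := fun x => S x = S' x)
    (isClosed_eq S.continuous S'.continuous) (by rw [map_zero, map_zero]) (fun f g => ?_)
    (fun u v hu hv => by rw [map_add, map_add, hu, hv]) x
  refine eq_of_forall_inner_eq (D := SpatialTensor π ρ) fun w => ?_
  have h1 : ∀ v : ExtTensorProduct π ρ M N,
      Continuous fun w => (inner (SpatialTensor π ρ) w v : SpatialTensor π ρ) := fun v =>
    (CStarModule.continuous_inner (A := SpatialTensor π ρ)).comp
      (continuous_id.prodMk continuous_const)
  refine ext_induction_etmul (p := fun w => inner (SpatialTensor π ρ) w (S (etmul π ρ f g)) =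
      inner (SpatialTensor π ρ) w (S' (etmul π ρ f g)))
    (isClosed_eq (h1 _) (h1 _)) (by rw [CStarModule.inner_zero_left, CStarModule.inner_zero_left])
    (fun f' g' => h f f' g g')
    (fun u v hu hv => by rw [CStarModule.inner_add_left, CStarModule.inner_add_left, hu, hv]) w

end ElementaryTensors

/-! ### Tensor products of biframes and their operators -/

section TensorBiframes

variable {A B H K : Type*} [CStarAlgebra A] [PartialOrder A] [StarOrderedRing A]
  [CStarAlgebra B] [PartialOrder B] [StarOrderedRing B]
  [NormedAddCommGroup H] [InnerProductSpace ℂ H] [CompleteSpace H]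
  [NormedAddCommGroup K] [InnerProductSpace ℂ K] [CompleteSpace K]
  {π : A →⋆ₐ[ℂ] (H →L[ℂ] H)} {ρ : B →⋆ₐ[ℂ] (K →L[ℂ] K)}

/-- The difference is `P ⊗ (Q - c q) + (P - a p) ⊗ c q`, a sum of tensors of positive elements. -/
theorem smul_stmul_le_stmul {p P : A} {q Q : B} {a c : ℝ} (ha : 0 ≤ a) (hc : 0 ≤ c)
    (hp : 0 ≤ p) (hq : 0 ≤ q) (hP : a • p ≤ P) (hQ : c • q ≤ Q) :
    (a * c) • stmul π ρ p q ≤ stmul π ρ P Q := by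
  have h1 := stmul_nonneg π ρ ((smul_nonneg ha hp).trans hP) (sub_nonneg.2 hQ)
  have h2 := stmul_nonneg π ρ (sub_nonneg.2 hP) (smul_nonneg hc hq)
  have h := add_nonneg h1 h2
  rw [← sub_nonneg]
  refine h.trans_eq ?_
  simp only [← stmulL_apply, ← Complex.coe_smul, map_sub, map_smul, sub_apply, smul_apply,
    mul_smul, smul_sub]
  rw [smul_comm (c : ℂ) (a : ℂ)]
  abel

/-- The difference is `P ⊗ (d q - Q) + (b p - P) ⊗ d q`. -/
theorem stmul_le_smul_stmul {p P : A} {q Q : B} {b d : ℝ} (hd : 0 ≤ d)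
    (hq : 0 ≤ q) (hP0 : 0 ≤ P) (hP : P ≤ b • p) (hQ : Q ≤ d • q) :
    stmul π ρ P Q ≤ (b * d) • stmul π ρ p q := by
  have h1 := stmul_nonneg π ρ hP0 (sub_nonneg.2 hQ)
  have h2 := stmul_nonneg π ρ (sub_nonneg.2 hP) (smul_nonneg hd hq)
  have h := add_nonneg h1 h2
  rw [← sub_nonneg]
  refine h.trans_eq ?_
  simp only [← stmulL_apply, ← Complex.coe_smul, map_sub, map_smul, sub_apply, smul_apply,
    mul_smul, smul_sub]
  rw [smul_comm (d : ℂ) (b : ℂ)]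
  abel

variable {M N : Type*}
  [NormedAddCommGroup M] [NormedSpace ℂ M] [Module A M] [IsScalarTower ℂ A M] [CStarModule A M]
  [NormedAddCommGroup N] [NormedSpace ℂ N] [Module B N] [IsScalarTower ℂ B N] [CStarModule B N]
  {Ω₁ Ω₂ : Type*} {X₁ Y₁ : Ω₁ → M} {X₂ Y₂ : Ω₂ → N}

theorem inner_tensorMap (f : M) (g : N) (ω : Ω₁ × Ω₂) :
    ⟪etmul π ρ f g, tensorMap π ρ X₁ X₂ ω⟫ₗ[SpatialTensor π ρ] =
      stmulL π ρ ⟪f, X₁ ω.1⟫ₗ[A] ⟪g, X₂ ω.2⟫ₗ[B] :=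
  inner_etmul _ _ _ _

theorem inner_tensorMap_mul_inner_tensorMap (f f' : M) (g g' : N) (ω : Ω₁ × Ω₂) :
    ⟪etmul π ρ f g, tensorMap π ρ X₁ X₂ ω⟫ₗ[SpatialTensor π ρ] *
        ⟪tensorMap π ρ Y₁ Y₂ ω, etmul π ρ f' g'⟫ₗ[SpatialTensor π ρ] =
      stmulL π ρ (⟪f, X₁ ω.1⟫ₗ[A] * ⟪Y₁ ω.1, f'⟫ₗ[A]) (⟪g, X₂ ω.2⟫ₗ[B] * ⟪Y₂ ω.2, g'⟫ₗ[B]) := by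
  rw [tensorMap, tensorMap, inner_etmul, inner_etmul, stmul_mul_stmul, stmulL_apply]

theorem inner_tensorMap_smul_tensorMap (f : M) (g : N) (ω : Ω₁ × Ω₂) :
    ⟪etmul π ρ f g, tensorMap π ρ X₁ X₂ ω⟫ₗ[SpatialTensor π ρ] • tensorMap π ρ Y₁ Y₂ ω =
      etmulL π ρ (⟪f, X₁ ω.1⟫ₗ[A] • Y₁ ω.1) (⟪g, X₂ ω.2⟫ₗ[B] • Y₂ ω.2) := by
  rw [tensorMap, tensorMap, inner_etmul, stmul_smul_etmul, etmulL_apply]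

variable [MeasurableSpace Ω₁] [MeasurableSpace Ω₂]
  {μ₁ : Measure Ω₁} {μ₂ : Measure Ω₂} {μ : Measure (Ω₁ × Ω₂)}

/-- The projections pull null sets back to null sets, so almost everywhere strong measurability
lifts to the product and is preserved by the bounded bilinear map. -/
theorem aestronglyMeasurable_inner_tensorMap
    (hμ : ∀ s t, MeasurableSet s → MeasurableSet t → μ (s ×ˢ t) = μ₁ s * μ₂ t) {f : M} {g : N}
    (h₁ : AEStronglyMeasurable (fun ω => ⟪f, X₁ ω⟫ₗ[A]) μ₁)
    (h₂ : AEStronglyMeasurable (fun ω => ⟪g, X₂ ω⟫ₗ[B]) μ₂) :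
    AEStronglyMeasurable
      (fun ω => ⟪etmul π ρ f g, tensorMap π ρ X₁ X₂ ω⟫ₗ[SpatialTensor π ρ]) μ := by
  simp only [inner_tensorMap]
  exact (stmulL π ρ).aestronglyMeasurable_comp₂
    (h₁.comp_quasiMeasurePreserving (quasiMeasurePreserving_fst_of_prod hμ))
    (h₂.comp_quasiMeasurePreserving (quasiMeasurePreserving_snd_of_prod hμ))

/-- The integrand is `stmulL` of the integrands of the two factors. The case `f = f'`, `g = g'`
serves the biframe inequalities, the general case the weak formula. -/
theorem integrable_and_integral_inner_tensorMap
    (hμ : ∀ s t, MeasurableSet s → MeasurableSet t → μ (s ×ˢ t) = μ₁ s * μ₂ t) {f f' : M} {g g' : N}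
    (h₁ : Integrable (fun ω => ⟪f, X₁ ω⟫ₗ[A] * ⟪Y₁ ω, f'⟫ₗ[A]) μ₁)
    (h₂ : Integrable (fun ω => ⟪g, X₂ ω⟫ₗ[B] * ⟪Y₂ ω, g'⟫ₗ[B]) μ₂) :
    Integrable (fun ω => ⟪etmul π ρ f g, tensorMap π ρ X₁ X₂ ω⟫ₗ[SpatialTensor π ρ] *
        ⟪tensorMap π ρ Y₁ Y₂ ω, etmul π ρ f' g'⟫ₗ[SpatialTensor π ρ]) μ ∧
      ∫ ω, ⟪etmul π ρ f g, tensorMap π ρ X₁ X₂ ω⟫ₗ[SpatialTensor π ρ] *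
        ⟪tensorMap π ρ Y₁ Y₂ ω, etmul π ρ f' g'⟫ₗ[SpatialTensor π ρ] ∂μ =
      stmul π ρ (∫ ω, ⟪f, X₁ ω⟫ₗ[A] * ⟪Y₁ ω, f'⟫ₗ[A] ∂μ₁)
        (∫ ω, ⟪g, X₂ ω⟫ₗ[B] * ⟪Y₂ ω, g'⟫ₗ[B] ∂μ₂) := by
  have h := integrable_and_integral_bilin_of_prod hμ (stmulL π ρ) h₁ h₂
  simp only [inner_tensorMap_mul_inner_tensorMap, ← stmulL_apply]
  exact h

variable {a b c d : ℝ}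

/-- The tensor product of two continuous biframes is a continuous biframe. -/
theorem isContinuousBiframeOn_tensorMap
    (hμ : ∀ s t, MeasurableSet s → MeasurableSet t → μ (s ×ˢ t) = μ₁ s * μ₂ t)
    (h₁ : IsContinuousBiframeOn A Set.univ μ₁ X₁ Y₁ a b)
    (h₂ : IsContinuousBiframeOn B Set.univ μ₂ X₂ Y₂ c d) :
    IsContinuousBiframeOn (SpatialTensor π ρ) (elementaryTensors π ρ M N) μ
      (tensorMap π ρ X₁ X₂) (tensorMap π ρ Y₁ Y₂) (a * c) (b * d) := by
  have key := fun (f : M) (g : N) => integrable_and_integral_inner_tensorMap (π := π) (ρ := ρ) hμ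
    (h₁.integrable f trivial) (h₂.integrable g trivial)
  refine ⟨mul_pos h₁.pos h₂.pos, mul_le_mul h₁.le h₂.le h₂.pos.le (h₁.pos.le.trans h₁.le),
    ?_, ?_, ?_, ?_, ?_⟩
  · rintro _ ⟨f, g, rfl⟩
    exact aestronglyMeasurable_inner_tensorMap hμ (h₁.measurable_left f trivial)
      (h₂.measurable_left g trivial)
  · rintro _ ⟨f, g, rfl⟩
    exact aestronglyMeasurable_inner_tensorMap hμ (h₁.measurable_right f trivial)
      (h₂.measurable_right g trivial)
  · rintro _ ⟨f, g, rfl⟩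
    exact (key f g).1
  · rintro _ ⟨f, g, rfl⟩
    rw [(key f g).2, inner_etmul]
    exact smul_stmul_le_stmul h₁.pos.le h₂.pos.le CStarModule.inner_self_nonneg
      CStarModule.inner_self_nonneg (h₁.lower_bound f trivial) (h₂.lower_bound g trivial)
  · rintro _ ⟨f, g, rfl⟩
    rw [(key f g).2, inner_etmul]
    exact stmul_le_smul_stmul (h₂.pos.le.trans h₂.le) CStarModule.inner_self_nonneg
      ((smul_nonneg h₁.pos.le CStarModule.inner_self_nonneg).trans (h₁.lower_bound f trivial))
      (h₁.upper_bound f trivial) (h₂.upper_bound g trivial)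

/-- An operator with `S (f ⊗ g) = S₁ f ⊗ S₂ g` is a biframe operator of the tensor product. -/
theorem isBiframeOperatorOn_tensorMap
    (hμ : ∀ s t, MeasurableSet s → MeasurableSet t → μ (s ×ˢ t) = μ₁ s * μ₂ t)
    {S₁ : M → M} (hS₁ : IsBiframeOperatorOn A Set.univ μ₁ X₁ Y₁ S₁)
    {S₂ : N → N} (hS₂ : IsBiframeOperatorOn B Set.univ μ₂ X₂ Y₂ S₂)
    {S : ExtTensorProduct π ρ M N → ExtTensorProduct π ρ M N}
    (hS : ∀ f g, S (etmul π ρ f g) = etmul π ρ (S₁ f) (S₂ g)) :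
    IsBiframeOperatorOn (SpatialTensor π ρ) (elementaryTensors π ρ M N) μ
      (tensorMap π ρ X₁ X₂) (tensorMap π ρ Y₁ Y₂) S := by
  rintro _ ⟨f, g, rfl⟩ _ ⟨f', g', rfl⟩
  have key := integrable_and_integral_inner_tensorMap (π := π) (ρ := ρ) hμ
    (hS₁ f trivial f' trivial).1 (hS₂ g trivial g' trivial).1
  refine ⟨key.1, ?_⟩
  rw [key.2, hS, inner_etmul, (hS₁ f trivial f' trivial).2, (hS₂ g trivial g' trivial).2]

/-- Two bounded biframe operators of the same pair coincide. -/
theorem eq_of_isBiframeOperatorOn_elementaryTensors {X Y : Ω₁ × Ω₂ → ExtTensorProduct π ρ M N}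
    {S S' : ExtTensorProduct π ρ M N →L[ℂ] ExtTensorProduct π ρ M N}
    (hS : IsBiframeOperatorOn (SpatialTensor π ρ) (elementaryTensors π ρ M N) μ X Y S)
    (hS' : IsBiframeOperatorOn (SpatialTensor π ρ) (elementaryTensors π ρ M N) μ X Y S') :
    S = S' :=
  eq_of_inner_etmul_eq fun f f' g g' =>
    (hS _ ⟨f, g, rfl⟩ _ ⟨f', g', rfl⟩).2.trans (hS' _ ⟨f, g, rfl⟩ _ ⟨f', g', rfl⟩).2.symm

/-- A weak integral agrees with the Bochner integral when the latter exists. -/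
theorem integral_eq_of_isBiframeOperatorOn [CompleteSpace M] {S : M → M}
    (hS : IsBiframeOperatorOn A Set.univ μ₁ X₁ Y₁ S) {f : M}
    (hf : Integrable (fun ω => ⟪f, X₁ ω⟫ₗ[A] • Y₁ ω) μ₁) :
    ∫ ω, ⟪f, X₁ ω⟫ₗ[A] • Y₁ ω ∂μ₁ = S f := by
  refine eq_of_forall_inner_eq (D := A) fun z => ?_
  -- Pairing with `z` is a bounded linear map, so it commutes with the Bochner integral.
  have h1 := (CStarModule.innerSL (A := A) z).integral_comp_comm hf
  simp only [CStarModule.innerSL_apply, CStarModule.inner_op_smul_right] at h1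
  rw [← h1, (hS f trivial z trivial).2]

/-- The same factorization with `etmulL` in place of `stmulL`; the vector-valued integrals of the
factors are `S₁ f` and `S₂ g`. -/
theorem integrable_and_integral_smul_tensorMap [CompleteSpace M] [CompleteSpace N]
    (hμ : ∀ s t, MeasurableSet s → MeasurableSet t → μ (s ×ˢ t) = μ₁ s * μ₂ t)
    {S₁ : M → M} (hS₁ : IsBiframeOperatorOn A Set.univ μ₁ X₁ Y₁ S₁)
    {S₂ : N → N} (hS₂ : IsBiframeOperatorOn B Set.univ μ₂ X₂ Y₂ S₂) {f : M} {g : N}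
    (hf : Integrable (fun ω => ⟪f, X₁ ω⟫ₗ[A] • Y₁ ω) μ₁)
    (hg : Integrable (fun ω => ⟪g, X₂ ω⟫ₗ[B] • Y₂ ω) μ₂) :
    Integrable (fun ω => ⟪etmul π ρ f g, tensorMap π ρ X₁ X₂ ω⟫ₗ[SpatialTensor π ρ] •
        tensorMap π ρ Y₁ Y₂ ω) μ ∧
      ∫ ω, ⟪etmul π ρ f g, tensorMap π ρ X₁ X₂ ω⟫ₗ[SpatialTensor π ρ] •
        tensorMap π ρ Y₁ Y₂ ω ∂μ = etmul π ρ (S₁ f) (S₂ g) := by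
  simp only [inner_tensorMap_smul_tensorMap]
  rw [← integral_eq_of_isBiframeOperatorOn hS₁ hf, ← integral_eq_of_isBiframeOperatorOn hS₂ hg,
    ← etmulL_apply]
  have h := integrable_and_integral_bilin_of_prod hμ (etmulL π ρ) hf hg
  exact h

/-- The tensor product `S₁ ⊗ S₂` of the biframe operators of two biframes is a symmetric bounded
operator, between the products of the bounds. -/
theorem exists_tensor_of_biframeOperators
    (h₁ : IsContinuousBiframeOn A Set.univ μ₁ X₁ Y₁ a b)
    (h₂ : IsContinuousBiframeOn B Set.univ μ₂ X₂ Y₂ c d)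
    {S₁ : M → M} (hS₁ : IsBiframeOperatorOn A Set.univ μ₁ X₁ Y₁ S₁)
    {S₂ : N → N} (hS₂ : IsBiframeOperatorOn B Set.univ μ₂ X₂ Y₂ S₂) :
    ∃ S : ExtTensorProduct π ρ M N →L[ℂ] ExtTensorProduct π ρ M N,
      (∀ f g, S (etmul π ρ f g) = etmul π ρ (S₁ f) (S₂ g)) ∧
      (∀ x y, inner (SpatialTensor π ρ) (S x) y = inner (SpatialTensor π ρ) x (S y)) ∧
      (∀ x, (a * c) • inner (SpatialTensor π ρ) x x ≤ inner (SpatialTensor π ρ) x (S x)) ∧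
      ∀ x, inner (SpatialTensor π ρ) x (S x) ≤ (b * d) • inner (SpatialTensor π ρ) x x := by
  obtain ⟨T, hT, hTs, hTa, hTb⟩ := exists_symmetric_linearMap_of_isContinuousBiframeOn h₁ hS₁
  obtain ⟨P, hP, hPs, hPc, hPd⟩ := exists_symmetric_linearMap_of_isContinuousBiframeOn h₂ hS₂
  obtain ⟨S, hS, hSs⟩ := exists_extension_of_symmetric (π := π) (ρ := ρ) (U := preMap π ρ T P)
    (mul_pos h₁.pos h₂.pos).le
    (mul_pos (h₁.pos.trans_le h₁.le) (h₂.pos.trans_le h₂.le))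
    (preInner_preMap_left hTs hPs)
    (smul_preInner_le_preMap h₁.pos.le h₂.pos.le hTs hTa hPs hPc)
    (preMap_le_smul_preInner (h₂.pos.le.trans h₂.le) hTs
      (fun x => (smul_nonneg h₁.pos.le CStarModule.inner_self_nonneg).trans (hTa x)) hTb hPs hPd)
  refine ⟨S, fun f g => ?_, hSs⟩
  rw [← hT, ← hP]
  exact hS _

end TensorBiframes

theorem mainTheorem6
    {A : Type*} [CStarAlgebra A] [PartialOrder A] [StarOrderedRing A]
    {H K : Type*} [NormedAddCommGroup H] [InnerProductSpace ℂ H] [CompleteSpace H]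
    [NormedAddCommGroup K] [InnerProductSpace ℂ K] [CompleteSpace K]
    -- faithful representations, used to form the spatial tensor product of `A` with itself
    (π : A →⋆ₐ[ℂ] (H →L[ℂ] H)) (_hπ : Function.Injective π)
    (ρ : A →⋆ₐ[ℂ] (K →L[ℂ] K)) (_hρ : Function.Injective ρ)
    {M₁ : Type*} [NormedAddCommGroup M₁] [NormedSpace ℂ M₁] [Module A M₁] [IsScalarTower ℂ A M₁]
    [CStarModule A M₁] [CompleteSpace M₁]
    {M₂ : Type*} [NormedAddCommGroup M₂] [NormedSpace ℂ M₂] [Module A M₂] [IsScalarTower ℂ A M₂]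
    [CStarModule A M₂] [CompleteSpace M₂]
    {Ω₁ Ω₂ : Type*} [MeasurableSpace Ω₁] [MeasurableSpace Ω₂]
    (μ₁ : Measure Ω₁) (μ₂ : Measure Ω₂) (μ : Measure (Ω₁ × Ω₂))
    -- `μ` is a product measure of `μ₁` and `μ₂`
    (hμ : ∀ s t, MeasurableSet s → MeasurableSet t → μ (s ×ˢ t) = μ₁ s * μ₂ t)
    (X₁ Y₁ : Ω₁ → M₁) (X₂ Y₂ : Ω₂ → M₂) (a b c d : ℝ)
    (h₁ : IsContinuousBiframeOn A Set.univ μ₁ X₁ Y₁ a b)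
    (h₂ : IsContinuousBiframeOn A Set.univ μ₂ X₂ Y₂ c d)
    (S₁ : M₁ → M₁) (hS₁ : IsBiframeOperatorOn A Set.univ μ₁ X₁ Y₁ S₁)
    (S₂ : M₂ → M₂) (hS₂ : IsBiframeOperatorOn A Set.univ μ₂ X₂ Y₂ S₂) :
    -- the induced pair is a continuous biframe with bounds `a c` and `b d`
    IsContinuousBiframeOn (SpatialTensor π ρ) (elementaryTensors π ρ M₁ M₂) μ
      (tensorMap π ρ X₁ X₂) (tensorMap π ρ Y₁ Y₂) (a * c) (b * d) ∧
    -- and it has a unique biframe operator `S`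
    ∃ S : adjointableOperators (SpatialTensor π ρ) (ExtTensorProduct π ρ M₁ M₂),
      IsBiframeOperatorOn (SpatialTensor π ρ) (elementaryTensors π ρ M₁ M₂) μ
        (tensorMap π ρ X₁ X₂) (tensorMap π ρ Y₁ Y₂) S.1 ∧
      (∀ S' : ExtTensorProduct π ρ M₁ M₂ →L[ℂ] ExtTensorProduct π ρ M₁ M₂,
        IsBiframeOperatorOn (SpatialTensor π ρ) (elementaryTensors π ρ M₁ M₂) μ
          (tensorMap π ρ X₁ X₂) (tensorMap π ρ Y₁ Y₂) S' → S' = S.1) ∧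
      -- which is given by Bochner integrals wherever those on the two factors exist
      (∀ (f : M₁) (g : M₂),
        Integrable (fun ω => ⟪f, X₁ ω⟫ₗ[A] • Y₁ ω) μ₁ →
        Integrable (fun ω => ⟪g, X₂ ω⟫ₗ[A] • Y₂ ω) μ₂ →
        Integrable (fun ω => ⟪etmul π ρ f g, tensorMap π ρ X₁ X₂ ω⟫ₗ[SpatialTensor π ρ] •
          tensorMap π ρ Y₁ Y₂ ω) μ ∧
        S.1 (etmul π ρ f g) =
          ∫ ω, ⟪etmul π ρ f g, tensorMap π ρ X₁ X₂ ω⟫ₗ[SpatialTensor π ρ] •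
            tensorMap π ρ Y₁ Y₂ ω ∂μ) ∧
      -- `a c I ≤ S ≤ b d I`
      OperatorLE (SpatialTensor π ρ) (((a * c : ℝ) : ℂ) • 1) S.1 ∧
      OperatorLE (SpatialTensor π ρ) S.1 (((b * d : ℝ) : ℂ) • 1) ∧
      -- `S` is positive and invertible, with spectrum in `[a c, b d]`
      OperatorLE (SpatialTensor π ρ) 0 S.1 ∧
      IsUnit S ∧
      spectrum ℂ S ⊆ (fun r : ℝ => (r : ℂ)) '' Set.Icc (a * c) (b * d) := by
  obtain ⟨S, hSt, hSs, hSl, hSu⟩ :=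
    exists_tensor_of_biframeOperators (π := π) (ρ := ρ) h₁ h₂ hS₁ hS₂
  have hac : 0 < a * c := mul_pos h₁.pos h₂.pos
  have hle : a * c ≤ b * d := mul_le_mul h₁.le h₂.le h₂.pos.le (h₁.pos.le.trans h₁.le)
  have hb := isBiframeOperatorOn_tensorMap (π := π) (ρ := ρ) hμ hS₁ hS₂ hSt
  have hsc : ∀ (t : ℝ) (x : ExtTensorProduct π ρ M₁ M₂),
      inner (SpatialTensor π ρ) x ((((t : ℝ) : ℂ) •
        (1 : ExtTensorProduct π ρ M₁ M₂ →L[ℂ] ExtTensorProduct π ρ M₁ M₂)) x) =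
        t • inner (SpatialTensor π ρ) x x := fun t x =>
    (CStarModule.inner_smul_right_complex (A := SpatialTensor π ρ) (z := (t : ℂ))
      (x := x) (y := x)).trans (Complex.coe_smul t _)
  refine ⟨isContinuousBiframeOn_tensorMap hμ h₁ h₂,
    ⟨S, mem_adjointableOperators_of_symmetric hSs⟩, hb,
    fun S' hS' => eq_of_isBiframeOperatorOn_elementaryTensors hS' hb, fun f g hf hg => ?_,
    fun x => ?_, fun x => ?_, fun x => ?_, ?_, ?_⟩
  · have h := integrable_and_integral_smul_tensorMap (π := π) (ρ := ρ) hμ hS₁ hS₂ hf hg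
    exact ⟨h.1, (hSt f g).trans h.2.symm⟩
  · rw [hsc]
    exact hSl x
  · rw [hsc]
    exact hSu x
  · rw [zero_apply, CStarModule.inner_zero_right]
    exact (smul_nonneg hac.le CStarModule.inner_self_nonneg).trans (hSl x)
  · exact isUnit_of_symmetric_of_bounds hac hSs hSl hSu
  · exact spectrum_subset_of_symmetric_of_bounds hac hle hSs hSl hSu
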